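/- All graphs are finite, simple and undirected. A \emph{burning schedule} $\langle a_1,\dots,a_k\rangle$ on $G$ is a sequence of vertices; in round $i$ every fire spreads to all neighbouring vertices and a new fire is started at $a_i$. The schedule burns $G$ in $k$ rounds if all vertices are on fire after round $k$, and the burning number $bn(G)$ is the least $k$ for which such a schedule exists. A \emph{path decomposition} of $G$ is a finite sequence of bags (sets of vertices) such that every vertex lies in a bag, every edge is contained in a bag, and the bags containing a given vertex are consecutive. Its \emph{length} is the maximum distance in $G$ between two vertices of the same bag; the \emph{path-length} $pl(G)$ is the minimum length of a path decomposition of $G$. An algorithm is a program for a random access machine (registers, integer-indexed tables of natural numbers, branching and loops; addition, truncated subtraction and comparison at unit cost). Its input is the adjacency matrix of a graph $G$ on $\{0,\dots,n-1\}$ and, optionally, a path decomposition $D$ of $G$ with $\xi$ bags given by its incidence matrix ($\xi=0$ if no decomposition is supplied). \textbf{Corollary.} For every constant $c\ge 1$ there is an algorithm that, on every connected graph $G$, with or without a path decomposition $D$ of $G$, runs in time polynomial in $n+\xi$ and outputs a schedule that burns $G$ in some number $k$ of rounds, such that, with $d$ the diameter of $G$, and with $\ell$ the length of $D$ if $D$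 is supplied and $\ell=2\,pl(G)$ otherwise: \begin{enumerate} \item if $d\le c$, then $k=bn(G)$; \item if $d>c$, then $k\le\lceil\sqrt{d-1}\,\rceil+\ell$ and $\dfrac{k}{bn(G)}<1+\dfrac{\ell}{\sqrt d}$; \item consequently the approximation factor is $1+o(1)$ on graphs of bounded path-length: for every constant $L$ there is a function $\varepsilon:\mathbb N\to\mathbb R$ with $\varepsilon(d)\to0$ as $d\to\infty$ such that $k\le(1+\varepsilon(d))\,bn(G)$ for every connected graph $G$ with $pl(G)\le L$ and diameter $d$ (where the supplied decomposition, if any, also has length at most $L$). \end{enumerate} -/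

import Mathlib

namespace Burning

/-! ### The burning process -/

/-- One round of burning: every fire spreads to all neighbours, and a new fire is started
at the activator `a`. -/
def burnRound {V : Type*} (G : SimpleGraph V) (B : Set V) (a : V) : Set V :=
  insert a (B ∪ {v | ∃ u ∈ B, G.Adj u v})

/-- The set of vertices on fire after the last round, when the `i`-th entry of `s` is the
activator of round `i`. -/
def burnedAfter {V : Type*} (G : SimpleGraph V) (s : List V) : Set V :=
  s.foldl (burnRound G) ∅

/-- The schedule `s` burns the whole graph in `s.length` rounds. -/
def Burns {V : Type*} (G : SimpleGraph V) (s : List V) : Prop :=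
  burnedAfter G s = Set.univ

/-- The burning number: the least number of rounds in which the graph can be burned. -/
noncomputable def burningNumber {V : Type*} (G : SimpleGraph V) : ℕ :=
  sInf {k | ∃ s : List V, s.length = k ∧ Burns G s}

/-! ### Path decompositions and path-length -/

/-- A path decomposition of `G`: a finite sequence of bags such that each vertex lies in some
bag, each edge lies inside some bag, and the bags containing a given vertex are consecutive. -/
structure PathDecomposition {V : Type*} (G : SimpleGraph V) where
  numBags : ℕ
  bag : Fin numBags → Finset V
  vertex_mem : ∀ v, ∃ i, v ∈ bag i
  edge_mem : ∀ v w, G.Adj v w → ∃ i, v ∈ bag i ∧ w ∈ bag i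
  consecutive : ∀ v i j k, i ≤ j → j ≤ k → v ∈ bag i → v ∈ bag k → v ∈ bag j

/-- The length of a decomposition: the largest distance in `G` between two vertices of the
same bag (used for connected `G`, where all distances are finite). -/
noncomputable def PathDecomposition.length {V : Type*} {G : SimpleGraph V}
    (D : PathDecomposition G) : ℕ :=
  Finset.univ.sup fun i => (D.bag i).sup fun x => (D.bag i).sup fun y => G.dist x y

/-- The path-length of `G`: the least length of a path decomposition of `G`. -/
noncomputable def pathLength {V : Type*} (G : SimpleGraph V) : ℕ :=
  sInf {l | ∃ D : PathDecomposition G, D.length = l}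

/-! ### The machine model: structured programs for a random access machine

A program works on registers and on two-dimensional tables (indexed by natural numbers computed
at run time) that hold natural numbers. The arithmetic operations are addition, truncated
subtraction and comparison; there is no multiplication, so that in `t` steps numbers only
reach a bit length polynomial in `t` and in the input length. Each operation costs one step. -/

/-- The memory: registers `reg x` and tables `cell a i j`. -/
structure Store where
  reg : ℕ → ℕ
  cell : ℕ → ℕ → ℕ → ℕ

/-- Expressions; comparisons return `0` or `1`. -/
inductive Expr where
  | const (k : ℕ)
  | reg (x : ℕ)
  | cell (a : ℕ) (i j : Expr)
  | add (e f : Expr)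
  | sub (e f : Expr)
  | lt (e f : Expr)
  | eq (e f : Expr)

/-- The value of an expression. -/
def Expr.eval (s : Store) : Expr → ℕ
  | const k => k
  | reg x => s.reg x
  | cell a i j => s.cell a (i.eval s) (j.eval s)
  | add e f => e.eval s + f.eval s
  | sub e f => e.eval s - f.eval s
  | lt e f => if e.eval s < f.eval s then 1 else 0
  | eq e f => if e.eval s = f.eval s then 1 else 0

/-- The number of steps needed to evaluate an expression: one for each operation in it. -/
def Expr.cost : Expr → ℕ
  | const _ => 1
  | reg _ => 1
  | cell _ i j => i.cost + j.cost + 1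
  | add e f => e.cost + f.cost + 1
  | sub e f => e.cost + f.cost + 1
  | lt e f => e.cost + f.cost + 1
  | eq e f => e.cost + f.cost + 1

/-- Programs. A test `e` succeeds if its value is nonzero. -/
inductive Program where
  | skip
  | setReg (x : ℕ) (e : Expr)
  | setCell (a : ℕ) (i j e : Expr)
  | seq (p q : Program)
  | branch (e : Expr) (p q : Program)
  | loop (e : Expr) (p : Program)

/-- Overwrite register `x` by `v`. -/
def Store.setReg (s : Store) (x v : ℕ) : Store :=
  { s with reg := Function.update s.reg x v }

/-- Overwrite entry `(i, j)` of table `a` by `v`. -/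
def Store.setCell (s : Store) (a i j v : ℕ) : Store :=
  { s with
    cell := Function.update s.cell a
      (Function.update (s.cell a) i (Function.update (s.cell a i) j v)) }

/-- `Run p s s' t`: started in memory `s`, the program `p` halts in memory `s'` after exactly
`t` steps. -/
inductive Run : Program → Store → Store → ℕ → Prop
  | skip (s : Store) : Run .skip s s 1
  | setReg (s : Store) (x : ℕ) (e : Expr) :
      Run (.setReg x e) s (s.setReg x (e.eval s)) (e.cost + 1)
  | setCell (s : Store) (a : ℕ) (i j e : Expr) :
      Run (.setCell a i j e) s (s.setCell a (i.eval s) (j.eval s) (e.eval s))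
        (i.cost + j.cost + e.cost + 1)
  | seq {p q : Program} {s s' s'' : Store} {t t' : ℕ} :
      Run p s s' t → Run q s' s'' t' → Run (.seq p q) s s'' (t + t')
  | branch_true {e : Expr} {p q : Program} {s s' : Store} {t : ℕ} :
      e.eval s ≠ 0 → Run p s s' t → Run (.branch e p q) s s' (e.cost + 1 + t)
  | branch_false {e : Expr} {p q : Program} {s s' : Store} {t : ℕ} :
      e.eval s = 0 → Run q s s' t → Run (.branch e p q) s s' (e.cost + 1 + t)
  | loop_true {e : Expr} {p : Program} {s s' s'' : Store} {t t' : ℕ} :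
      e.eval s ≠ 0 → Run p s s' t → Run (.loop e p) s' s'' t' →
        Run (.loop e p) s s'' (e.cost + 1 + t + t')
  | loop_false {e : Expr} {p : Program} {s : Store} :
      e.eval s = 0 → Run (.loop e p) s s (e.cost + 1)

/-- Programs are deterministic: final memory and running time are determined by the input. -/
theorem Run.deterministic {p : Program} {s s₁ s₂ : Store} {t₁ t₂ : ℕ}
    (h₁ : Run p s s₁ t₁) (h₂ : Run p s s₂ t₂) : s₁ = s₂ ∧ t₁ = t₂ := by
  induction h₁ generalizing s₂ t₂ with
  | skip | setReg | setCell => cases h₂; exact ⟨rfl, rfl⟩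
  | seq _ _ ih ih' =>
    cases h₂ with
    | seq a b =>
      obtain ⟨rfl, rfl⟩ := ih a
      obtain ⟨rfl, rfl⟩ := ih' b
      exact ⟨rfl, rfl⟩
  | branch_true he _ ih =>
    cases h₂ with
    | branch_true _ a => obtain ⟨rfl, rfl⟩ := ih a; exact ⟨rfl, rfl⟩
    | branch_false h _ => exact absurd h he
  | branch_false he _ ih =>
    cases h₂ with
    | branch_true h _ => exact absurd he h
    | branch_false _ a => obtain ⟨rfl, rfl⟩ := ih a; exact ⟨rfl, rfl⟩
  | loop_true he _ _ ih ih' =>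
    cases h₂ with
    | loop_true _ a b =>
      obtain ⟨rfl, rfl⟩ := ih a
      obtain ⟨rfl, rfl⟩ := ih' b
      exact ⟨rfl, rfl⟩
    | loop_false h => exact absurd h he
  | loop_false he =>
    cases h₂ with
    | loop_true h _ _ => exact absurd he h
    | loop_false _ => exact ⟨rfl, rfl⟩

/-! ### Inputs and outputs

The input is a graph `G` on the vertices `0, …, n - 1`, possibly together with a path
decomposition of `G`. -/

/-- The number of bags of the decomposition supplied with the input, `0` if there is none. -/
def numBagsGiven {V : Type*} {G : SimpleGraph V} : Option (PathDecomposition G) → ℕ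
  | none => 0
  | some D => D.numBags

/-- The pair `(i, v)` is an incidence "vertex `v` lies in bag `i`" of the supplied decomposition;
there is none if no decomposition is supplied. -/
def BagGiven {n : ℕ} {G : SimpleGraph (Fin n)} :
    Option (PathDecomposition G) → ℕ → ℕ → Prop
  | none, _, _ => False
  | some D, i, v => ∃ (hi : i < D.numBags) (hv : v < n), ⟨v, hv⟩ ∈ D.bag ⟨i, hi⟩

open Classical in
/-- The initial memory: register `0` holds the number of vertices and table `0` the adjacency
matrix; register `1` holds the number of bags supplied (`0` if there is no decomposition) and
table `1` the bag-vertex incidence matrix. All other entries are `0`. -/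
noncomputable def inputStore {n : ℕ} (G : SimpleGraph (Fin n))
    (D : Option (PathDecomposition G)) : Store where
  reg x := if x = 0 then n else if x = 1 then numBagsGiven D else 0
  cell a i j :=
    if a = 0 then (if ∃ (hi : i < n) (hj : j < n), G.Adj ⟨i, hi⟩ ⟨j, hj⟩ then 1 else 0)
    else if a = 1 then (if BagGiven D i j then 1 else 0)
    else 0

/-- The final memory holds the schedule `σ`: its number of rounds in register `2`, and the
activators in the first column of table `2`. -/
def Store.Outputs {n : ℕ} (s : Store) (σ : List (Fin n)) : Prop :=
  s.reg 2 = σ.length ∧ ∀ (i : ℕ) (hi : i < σ.length), s.cell 2 i 0 = (σ[i] : ℕ)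

/-- `p` computes `A` in polynomial time: on every connected graph on `{0, …, n - 1}`, with or
without a path decomposition, it halts with output `A n G D` within a number of steps that is
polynomial in `n` plus the number of bags supplied. -/
def PolyTimeComputes (p : Program)
    (A : (n : ℕ) → (G : SimpleGraph (Fin n)) → Option (PathDecomposition G) → List (Fin n)) :
    Prop :=
  ∃ T : Polynomial ℕ, ∀ (n : ℕ) (G : SimpleGraph (Fin n)) (D : Option (PathDecomposition G)),
    G.Connected → ∃ (s : Store) (t : ℕ), Run p (inputStore G D) s t ∧
      t ≤ T.eval (n + numBagsGiven D) ∧ s.Outputs (A n G D)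

/-- The length of the decomposition that is available: that of the supplied one, or twice the
path-length of `G` if none is supplied. -/
noncomputable def availableLength {V : Type*} {G : SimpleGraph V} :
    Option (PathDecomposition G) → ℕ
  | none => 2 * pathLength G
  | some D => D.length

end Burning

/-! Lower bound. Take a geodesic between two vertices at distance d. A fire of radius r accounts for
at most 2r+1 of its d+1 vertices, so k rounds account for at most 1+3+…+(2k-1) = k² of them. Hence
√d < bn(G) (`diam_lt_sq_of_burns`).

Upper bound. In a path decomposition of length l, let u be a vertex whose last bag comes earliest
and v one whose first bag comes latest. Either one bag contains all vertices, or the interior of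
every walk from u to v comes within l of every vertex (`PathDecomposition.exists_dominating_pair`).
A shortest such walk has at most d-1 interior vertices. With t = ⌈√(d-1)⌉, fires of radii t-1, …, 0
tile t² ≥ d-1 consecutive positions, and l further rounds carry them to the whole graph
(`IsWalkSeq.burns`).

Algorithm. The decomposition occurs only in this analysis. The machine tries a shortest path between
every two vertices with every t, simulates each candidate schedule and keeps the best one that
passes. The bound therefore holds with pl(G), which is at most ℓ in both cases. For d ≤ c one has
bn(G) ≤ d+1 ≤ c+1, so trying all choices of the first c+1 activators finds an optimal schedule.
Whatever is recorded has been verified (`Cmd.check_spec`), and the record never gets worse, so it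
suffices that a good candidate occurs in some iteration (`Cmd.found_forN`).

Running time. Every loop has exactly n iterations and the nesting depth depends on c alone, so a
polynomial bound in n follows by recursion on the program (`Cmd.run_compile`). -/

namespace Burning

/-! ### A language of bounded loops -/

/-- Commands whose only loops are `for x < n`, where `n` is the content of register `0`. -/
inductive Cmd where
  | skip
  | setReg (x : ℕ) (e : Expr)
  | setCell (a : ℕ) (i j e : Expr)
  | seq (p q : Cmd)
  | branch (e : Expr) (p q : Cmd)
  | forN (x : ℕ) (p : Cmd)

namespace Cmd

/-- The program of a command. -/
def compile : Cmd → Program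
  | skip => .skip
  | setReg x e => .setReg x e
  | setCell a i j e => .setCell a i j e
  | seq p q => .seq p.compile q.compile
  | branch e p q => .branch e p.compile q.compile
  | forN x p => .seq (.setReg x (.const 0)) (.loop (.lt (.reg x) (.reg 0))
      (.seq p.compile (.setReg x (.add (.reg x) (.const 1)))))

/-- The memory after `k` iterations of `f` with loop register `x`. -/
def iter (x : ℕ) (f : Store → Store) (s : Store) : ℕ → Store
  | 0 => s.setReg x 0
  | k + 1 => (f (iter x f s k)).setReg x (k + 1)

/-- The memory after the execution of a command. -/
def exec : Cmd → Store → Store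
  | skip, s => s
  | setReg x e, s => s.setReg x (e.eval s)
  | setCell a i j e, s => s.setCell a (i.eval s) (j.eval s) (e.eval s)
  | seq p q, s => q.exec (p.exec s)
  | branch e p q, s => if e.eval s ≠ 0 then p.exec s else q.exec s
  | forN x p, s => iter x p.exec s (s.reg 0)

theorem exec_seq (p q : Cmd) (s : Store) : (seq p q).exec s = q.exec (p.exec s) := rfl

/-- The registers that a command may write. -/
def regs : Cmd → List ℕ
  | skip => []
  | setReg x _ => [x]
  | setCell _ _ _ _ => []
  | seq p q => p.regs ++ q.regs
  | branch _ p q => p.regs ++ q.regs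
  | forN x p => x :: p.regs

/-- The tables that a command may write. -/
def tabs : Cmd → List ℕ
  | skip => []
  | setReg _ _ => []
  | setCell a _ _ _ => [a]
  | seq p q => p.tabs ++ q.tabs
  | branch _ p q => p.tabs ++ q.tabs
  | forN _ p => p.tabs

/-- Register `0` is never written, and the body of a loop does not write the loop register. -/
def WF : Cmd → Prop
  | skip => True
  | setReg x _ => x ≠ 0
  | setCell _ _ _ _ => True
  | seq p q => p.WF ∧ q.WF
  | branch _ p q => p.WF ∧ q.WF
  | forN x p => x ≠ 0 ∧ x ∉ p.regs ∧ p.WF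

/-- A bound for the number of steps, as a polynomial in the content of register `0`. -/
noncomputable def cost : Cmd → Polynomial ℕ
  | skip => 1
  | setReg _ e => Polynomial.C (e.cost + 1)
  | setCell _ i j e => Polynomial.C (i.cost + j.cost + e.cost + 1)
  | seq p q => p.cost + q.cost
  | branch e p q => Polynomial.C (e.cost + 1) + p.cost + q.cost
  | forN _ p => Polynomial.C 6 + Polynomial.X * (p.cost + Polynomial.C 8)

end Cmd

/-! ### Memory updates, frame conditions and running time -/

@[simp] theorem Store.setReg_reg (s : Store) (x v y : ℕ) :
    (s.setReg x v).reg y = if y = x then v else s.reg y := by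
  simp [Store.setReg, Function.update_apply]

@[simp] theorem Store.setReg_cell (s : Store) (x v : ℕ) : (s.setReg x v).cell = s.cell := rfl

@[simp] theorem Store.setCell_reg (s : Store) (a i j v : ℕ) :
    (s.setCell a i j v).reg = s.reg := rfl

theorem Store.setCell_cell (s : Store) (a i j v b k l : ℕ) :
    (s.setCell a i j v).cell b k l = if b = a ∧ k = i ∧ l = j then v else s.cell b k l := by
  simp only [Store.setCell, Function.update_apply]
  by_cases h₁ : b = a <;> by_cases h₂ : k = i <;> by_cases h₃ : l = j <;>
    simp_all

theorem Store.setCell_cell_of_ne (s : Store) {a i j v b : ℕ} (h : b ≠ a) :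
    (s.setCell a i j v).cell b = s.cell b := by
  simp [Store.setCell, h]

/-- `s'` differs from `s` only in the registers `R` and the tables `T`. -/
def Frame (R T : List ℕ) (s s' : Store) : Prop :=
  (∀ r, r ∉ R → s'.reg r = s.reg r) ∧ ∀ a, a ∉ T → s'.cell a = s.cell a

namespace Cmd

theorem iter_frame {x : ℕ} {f : Store → Store} {s : Store} {R T : List ℕ}
    (hf : ∀ s, Frame R T s (f s)) (k : ℕ) : Frame (x :: R) T s (iter x f s k) := by
  induction k with
  | zero =>
    refine ⟨fun r hr => ?_, fun a _ => rfl⟩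
    simp only [List.mem_cons, not_or] at hr
    simp [iter, hr.1]
  | succ k ih =>
    refine ⟨fun r hr => ?_, fun a ha => ?_⟩
    · have := ih.1 r hr
      simp only [List.mem_cons, not_or] at hr
      simp [iter, hr.1, (hf _).1 r hr.2, this]
    · simp [iter, (hf _).2 a ha, ih.2 a ha]

theorem exec_frame (p : Cmd) (s : Store) : Frame p.regs p.tabs s (p.exec s) := by
  induction p generalizing s with
  | skip => exact ⟨fun _ _ => rfl, fun _ _ => rfl⟩
  | setReg x e =>
    refine ⟨fun r hr => ?_, fun _ _ => rfl⟩
    simp only [regs, List.mem_singleton] at hr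
    simp [exec, hr]
  | setCell a i j e =>
    refine ⟨fun _ _ => rfl, fun b hb => ?_⟩
    simp only [tabs, List.mem_singleton] at hb
    exact Store.setCell_cell_of_ne _ hb
  | seq p q ihp ihq =>
    refine ⟨fun r hr => ?_, fun a ha => ?_⟩
    · simp only [regs, List.mem_append, not_or] at hr
      simp [exec, (ihq _).1 r hr.2, (ihp _).1 r hr.1]
    · simp only [tabs, List.mem_append, not_or] at ha
      simp [exec, (ihq _).2 a ha.2, (ihp _).2 a ha.1]
  | branch e p q ihp ihq =>
    refine ⟨fun r hr => ?_, fun a ha => ?_⟩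
    · simp only [regs, List.mem_append, not_or] at hr
      by_cases h : e.eval s = 0
      · simp [exec, h, (ihq _).1 r hr.2]
      · simp [exec, h, (ihp _).1 r hr.1]
    · simp only [tabs, List.mem_append, not_or] at ha
      by_cases h : e.eval s = 0
      · simp [exec, h, (ihq _).2 a ha.2]
      · simp [exec, h, (ihp _).2 a ha.1]
  | forN x p ih => exact iter_frame ih _

theorem iter_reg_self (x : ℕ) (f : Store → Store) (s : Store) (k : ℕ) :
    (iter x f s k).reg x = k := by
  cases k <;> simp [iter]

/-- Register `0` bounds every loop and is the argument of the cost polynomial, so both remain fixed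
throughout a run. -/
theorem zero_notMem_regs {p : Cmd} (h : p.WF) : 0 ∉ p.regs := by
  induction p with
  | skip | setCell => simp [regs]
  | setReg x e => simpa [regs, WF, eq_comm] using h
  | seq p q ihp ihq | branch e p q ihp ihq => simp [regs, ihp h.1, ihq h.2]
  | forN x p ih => simp [regs, ih h.2.2, h.1.symm]

/-- The program of a command computes `exec` within the time bound `cost`. -/
theorem run_compile {p : Cmd} (h : p.WF) (s : Store) :
    ∃ t, Run p.compile s (p.exec s) t ∧ t ≤ p.cost.eval (s.reg 0) := by
  induction p generalizing s with
  | skip => exact ⟨_, .skip s, by simp [cost]⟩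
  | setReg x e => exact ⟨_, .setReg s x e, by simp [cost]⟩
  | setCell a i j e => exact ⟨_, .setCell s a i j e, by simp [cost]⟩
  | seq p q ihp ihq =>
    obtain ⟨t, ht, hle⟩ := ihp h.1 s
    obtain ⟨t', ht', hle'⟩ := ihq h.2 (p.exec s)
    rw [(p.exec_frame s).1 0 (zero_notMem_regs h.1)] at hle'
    exact ⟨_, .seq ht ht', by simp only [cost, Polynomial.eval_add]; omega⟩
  | branch e p q ihp ihq =>
    by_cases he : e.eval s = 0
    · obtain ⟨t, ht, hle⟩ := ihq h.2 s
      refine ⟨e.cost + 1 + t, ?_, ?_⟩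
      · simpa [exec, he, compile] using Run.branch_false he ht
      · simp only [cost, Polynomial.eval_add, Polynomial.eval_C]; omega
    · obtain ⟨t, ht, hle⟩ := ihp h.1 s
      refine ⟨e.cost + 1 + t, ?_, ?_⟩
      · simpa [exec, he, compile] using Run.branch_true he ht
      · simp only [cost, Polynomial.eval_add, Polynomial.eval_C]; omega
  | forN x p ih =>
    obtain ⟨hx, hxp, hp⟩ := h
    have h0 : ∀ k, (iter x p.exec s k).reg 0 = s.reg 0 := fun k =>
      (iter_frame (fun s => p.exec_frame s) k).1 0 (by simp [zero_notMem_regs hp, hx.symm])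
    -- Induction on the number j of iterations left. Besides the body, an iteration pays 4 for the
    -- test and 4 for the increment; the failing last test costs 4, and the initial assignment adds
    -- 2.
    have key : ∀ j k, j + k = s.reg 0 → ∃ t,
        Run (.loop (.lt (.reg x) (.reg 0))
          (.seq p.compile (.setReg x (.add (.reg x) (.const 1)))))
          (iter x p.exec s k) (iter x p.exec s (s.reg 0)) t ∧
        t ≤ j * (p.cost.eval (s.reg 0) + 8) + 4 := by
      intro j
      induction j with
      | zero =>
        intro k hk
        rw [← (show k = s.reg 0 by omega)]
        refine ⟨_, .loop_false ?_, by simp [Expr.cost]⟩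
        simp [Expr.eval, iter_reg_self, h0]; omega
      | succ j ihj =>
        intro k hk
        obtain ⟨t, ht, hle⟩ := ih hp (iter x p.exec s k)
        obtain ⟨t', ht', hle'⟩ := ihj (k + 1) (by omega)
        have hr : (p.exec (iter x p.exec s k)).reg x = k := by
          rw [(p.exec_frame _).1 x hxp, iter_reg_self]
        have hstep := Run.seq ht (Run.setReg _ x (.add (.reg x) (.const 1)))
        simp only [Expr.eval, hr] at hstep
        refine ⟨_, .loop_true ?_ hstep ht', ?_⟩
        · simp [Expr.eval, iter_reg_self, h0]; omega
        · rw [h0] at hle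
          simp only [Expr.cost, add_mul, one_mul]
          omega
    obtain ⟨t, ht, hle⟩ := key (s.reg 0) 0 (by omega)
    refine ⟨_, .seq (.setReg s x (.const 0)) ht, ?_⟩
    simp only [cost, Polynomial.eval_add, Polynomial.eval_C, Polynomial.eval_mul,
      Polynomial.eval_X, Expr.cost]
    omega

/-- Invariant rule for loops. -/
theorem forN_rule {x : ℕ} {p : Cmd} {s : Store} (P : ℕ → Store → Prop)
    (h₀ : P 0 (s.setReg x 0))
    (h₁ : ∀ k s', k < s.reg 0 → s'.reg x = k → Frame (x :: p.regs) p.tabs s s' → P k s' →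
      P (k + 1) ((p.exec s').setReg x (k + 1))) :
    P (s.reg 0) ((forN x p).exec s) := by
  have : ∀ k ≤ s.reg 0, P k (iter x p.exec s k) := by
    intro k
    induction k with
    | zero => exact fun _ => h₀
    | succ k ih =>
      exact fun hk => h₁ k _ (by omega) (iter_reg_self ..)
        (iter_frame (fun s => p.exec_frame s) k) (ih (by omega))
  exact this _ le_rfl

end Cmd

/-- Conjunction of tests. -/
def Expr.and (e f : Expr) : Expr := .lt (.const 1) (.add (.lt (.const 0) e) (.lt (.const 0) f))

@[simp] theorem Expr.eval_and_eq_zero {e f : Expr} {s : Store} :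
    (e.and f).eval s = 0 ↔ ¬(e.eval s ≠ 0 ∧ f.eval s ≠ 0) := by
  by_cases h : e.eval s = 0 <;> by_cases h' : f.eval s = 0 <;>
    simp [Expr.and, Expr.eval, h, h', Nat.pos_iff_ne_zero]

namespace Cmd

/-- For all `x < n`, if the test `e` succeeds, then assign `v` to register `r`. -/
def scan (x : ℕ) (e : Expr) (r : ℕ) (v : Expr) : Cmd := forN x (branch e (setReg r v) skip)

/-- Since neither the test nor the value depends on register `r`, the iterations do not interfere.
Which successful index wins is irrelevant for the applications. -/
theorem scan_exec {x r : ℕ} {e v : Expr} {s : Store} (hxr : x ≠ r)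
    (he : ∀ s w, e.eval (s.setReg r w) = e.eval s)
    (hv : ∀ s w, v.eval (s.setReg r w) = v.eval s) :
    ∃ w, (scan x e r v).exec s = (s.setReg r w).setReg x (s.reg 0) ∧
      ((∃ i < s.reg 0, e.eval (s.setReg x i) ≠ 0 ∧ w = v.eval (s.setReg x i)) ∨
        (∀ i < s.reg 0, e.eval (s.setReg x i) = 0) ∧ w = s.reg r) := by
  have hcomm : ∀ a b, (s.setReg r a).setReg x b = (s.setReg x b).setReg r a := by
    intro a b
    simp only [Store.setReg, Store.mk.injEq, and_true]
    exact Function.update_comm hxr.symm a b s.reg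
  have h2 : ∀ (s : Store) a b, (s.setReg x a).setReg x b = s.setReg x b := by
    intro s a b; simp [Store.setReg]
  have h2' : ∀ (s : Store) a b, (s.setReg r a).setReg r b = s.setReg r b := by
    intro s a b; simp [Store.setReg]
  refine forN_rule (fun k s' => ∃ w, s' = (s.setReg r w).setReg x k ∧
      ((∃ i < k, e.eval (s.setReg x i) ≠ 0 ∧ w = v.eval (s.setReg x i)) ∨
        (∀ i < k, e.eval (s.setReg x i) = 0) ∧ w = s.reg r)) ?_ ?_
  · refine ⟨s.reg r, ?_, Or.inr ⟨by simp, rfl⟩⟩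
    congr 1
    simp [Store.setReg]
  · rintro k s' hk - - ⟨w, rfl, h⟩
    by_cases hc : e.eval (s.setReg x k) = 0
    · refine ⟨w, ?_, ?_⟩
      · simp [exec, hcomm, he, hc]
        rw [← hcomm, h2, hcomm]
      · rcases h with ⟨i, hi, h⟩ | ⟨h, hw⟩
        · exact .inl ⟨i, by omega, h⟩
        · refine .inr ⟨fun i hi => ?_, hw⟩
          rcases Nat.lt_succ_iff_lt_or_eq.1 hi with h' | rfl
          exacts [h i h', hc]
    · refine ⟨v.eval (s.setReg x k), ?_, .inl ⟨k, by omega, hc, rfl⟩⟩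
      simp [exec, hcomm, he, hv, hc]
      rw [h2', ← hcomm, h2, hcomm]

end Cmd

/-! ### Burned sets and distances -/

section Distances

variable {V : Type*} {G : SimpleGraph V}

/-- For distinct vertices, take as w the neighbour of v on a geodesic to u. This is the spread of a
ball in one round. -/
theorem dist_le_succ_iff (hG : G.Connected) {u v : V} {r : ℕ} :
    G.dist u v ≤ r + 1 ↔ G.dist u v ≤ r ∨ ∃ w, G.dist u w ≤ r ∧ G.Adj w v := by
  constructor
  · intro h
    by_cases huv : u = v
    · exact .inl (by simp [huv])
    · obtain ⟨p, hp⟩ := hG.exists_walk_length_eq_dist v u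
      cases p with
      | nil => exact absurd rfl huv
      | cons hadj q =>
        rename_i w
        refine .inr ⟨w, ?_, hadj.symm⟩
        have := SimpleGraph.dist_le q
        rw [SimpleGraph.Walk.length_cons, SimpleGraph.dist_comm] at hp
        rw [SimpleGraph.dist_comm]
        omega
  · rintro (h | ⟨w, hw, hadj⟩)
    · omega
    · have := hG.dist_triangle (u := u) (v := w) (w := v)
      rw [SimpleGraph.dist_eq_one_iff_adj.2 hadj] at this
      omega

/-- The first `k` entries of a sequence, as a schedule. -/
def prefixList (f : ℕ → V) (k : ℕ) : List V := (List.range k).map f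

@[simp] theorem length_prefixList (f : ℕ → V) (k : ℕ) : (prefixList f k).length = k := by
  simp [prefixList]

theorem burnedAfter_prefixList_succ (f : ℕ → V) (k : ℕ) :
    burnedAfter G (prefixList f (k + 1)) = burnRound G (burnedAfter G (prefixList f k)) (f k) := by
  simp [burnedAfter, prefixList, List.range_succ]

theorem prefixList_congr {f g : ℕ → V} {k : ℕ} (h : ∀ i < k, f i = g i) :
    prefixList f k = prefixList g k :=
  List.map_congr_left fun i hi => h i (List.mem_range.1 hi)

theorem exists_prefixList_eq [Nonempty V] (σ : List V) :
    ∃ f : ℕ → V, σ = prefixList f σ.length := by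
  refine ⟨fun i => σ.getD i (Classical.arbitrary V), ?_⟩
  refine List.ext_getElem (by simp) fun i h₁ h₂ => ?_
  simp [prefixList, h₁]

/-- The fire of round `i` has radius `k - 1 - i` after round `k`. -/
theorem mem_burnedAfter_iff (hG : G.Connected) (f : ℕ → V) (k : ℕ) (v : V) :
    v ∈ burnedAfter G (prefixList f k) ↔ ∃ i r, i + r + 1 = k ∧ G.dist (f i) v ≤ r := by
  induction k generalizing v with
  | zero => simp [burnedAfter, prefixList]
  | succ k ih =>
    rw [burnedAfter_prefixList_succ, burnRound, Set.mem_insert_iff, Set.mem_union]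
    simp only [Set.mem_ofPred_eq, ih]
    constructor
    · rintro (rfl | ⟨i, r, h, hd⟩ | ⟨u, ⟨i, r, h, hd⟩, hadj⟩)
      · exact ⟨k, 0, rfl, by simp⟩
      · exact ⟨i, r + 1, by omega, by omega⟩
      · exact ⟨i, r + 1, by omega, (dist_le_succ_iff hG).2 (.inr ⟨u, hd, hadj⟩)⟩
    · rintro ⟨i, r, h, hd⟩
      cases r with
      | zero =>
        obtain rfl : i = k := by omega
        exact .inl (hG.dist_eq_zero_iff.1 (by omega)).symm
      | succ r =>
        rcases (dist_le_succ_iff hG).1 hd with hd | ⟨u, hd, hadj⟩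
        · exact .inr (.inl ⟨i, r, by omega, hd⟩)
        · exact .inr (.inr ⟨u, ⟨i, r, by omega, hd⟩, hadj⟩)

theorem burns_prefixList_iff (hG : G.Connected) (f : ℕ → V) (k : ℕ) :
    Burns G (prefixList f k) ↔ ∀ v, ∃ i r, i + r + 1 = k ∧ G.dist (f i) v ≤ r := by
  simp [Burns, Set.eq_univ_iff_forall, mem_burnedAfter_iff hG]

theorem dist_le_diam [Finite V] (hG : G.Connected) (u v : V) : G.dist u v ≤ G.diam :=
  have := hG.nonempty
  SimpleGraph.dist_le_diam (SimpleGraph.connected_iff_ediam_ne_top.1 hG)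

theorem burns_prefixList_const (hG : G.Connected) (v : V) {d : ℕ} (h : ∀ x, G.dist v x ≤ d) :
    Burns G (prefixList (fun _ => v) (d + 1)) :=
  (burns_prefixList_iff hG _ _).2 fun x => ⟨0, d, by omega, h x⟩

theorem burningNumber_le {s : List V} (h : Burns G s) : burningNumber G ≤ s.length :=
  Nat.sInf_le ⟨s, rfl, h⟩

theorem exists_burns_length_eq [Finite V] (hG : G.Connected) :
    ∃ s : List V, s.length = burningNumber G ∧ Burns G s :=
  have ⟨v⟩ := hG.nonempty
  Nat.sInf_mem (s := {k | ∃ s : List V, s.length = k ∧ Burns G s})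
    ⟨_, _, rfl, burns_prefixList_const hG v (dist_le_diam hG v)⟩

theorem burningNumber_le_diam [Finite V] (hG : G.Connected) : burningNumber G ≤ G.diam + 1 :=
  have ⟨v⟩ := hG.nonempty
  (burningNumber_le (burns_prefixList_const hG v (dist_le_diam hG v))).trans (by simp)

/-- Lower bound: the fires of `k` rounds cover at most `k ^ 2` vertices of a geodesic. -/
theorem diam_lt_sq_of_burns (hG : G.Connected) {s : List V} (hs : Burns G s) :
    G.diam < s.length * s.length := by
  have := hG.nonempty
  obtain ⟨f, hf⟩ := exists_prefixList_eq s
  generalize s.length = k at hf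
  subst hf
  rw [burns_prefixList_iff hG] at hs
  obtain ⟨u, v, huv⟩ := G.exists_dist_eq_diam
  obtain ⟨p, hp⟩ := hG.exists_walk_length_eq_dist u v
  -- The j-th vertex of the geodesic: the parts before and after it have lengths at most j and d -
  -- j, and the triangle inequality makes both tight.
  have hpos : ∀ j ≤ G.diam, ∃ x, G.dist u x = j := by
    intro j hj
    refine ⟨p.getVert j, ?_⟩
    have h₁ := SimpleGraph.dist_le (p.take j)
    have h₂ := SimpleGraph.dist_le (p.drop j)
    rw [SimpleGraph.Walk.take_length] at h₁
    rw [SimpleGraph.Walk.drop_length] at h₂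
    have h₃ := hG.dist_triangle (u := u) (v := p.getVert j) (w := v)
    omega
  -- The distance from u is 1-Lipschitz, so it maps a ball of radius r into an interval of at most
  -- 2r+1 integers; truncated subtraction only shortens that interval.
  have hcov : Finset.range (G.diam + 1) ⊆ (Finset.range k).biUnion fun i =>
      Finset.Icc (G.dist u (f i) - (k - 1 - i)) (G.dist u (f i) + (k - 1 - i)) := by
    intro j hj
    obtain ⟨x, rfl⟩ := hpos j (by simpa [Nat.lt_succ_iff] using hj)
    obtain ⟨i, r, hir, hd⟩ := hs x
    have h₁ := hG.dist_triangle (u := u) (v := f i) (w := x)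
    have h₂ := hG.dist_triangle (u := u) (v := x) (w := f i)
    rw [SimpleGraph.dist_comm (u := x)] at h₂
    simp only [Finset.mem_biUnion, Finset.mem_range, Finset.mem_Icc]
    exact ⟨i, by omega, by omega, by omega⟩
  have hsum : ∀ k : ℕ, ∑ i ∈ Finset.range k, (2 * (k - 1 - i) + 1) = k * k := by
    intro k
    rw [Finset.sum_range_reflect (fun i => 2 * i + 1) k]
    induction k with
    | zero => rfl
    | succ k ih => rw [Finset.sum_range_succ, ih]; ring
  have hcard := (Finset.card_le_card hcov).trans Finset.card_biUnion_le
  rw [Finset.card_range] at hcard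
  have := hcard.trans (Finset.sum_le_sum fun i _ =>
    (show _ ≤ 2 * (k - 1 - i) + 1 by rw [Nat.card_Icc]; omega))
  rw [hsum] at this
  simpa using this

end Distances

/-! ### Path decompositions and geodesics -/

section Decompositions

variable {V : Type*} {G : SimpleGraph V}

/-- The sequence `p` runs along a walk from `u` to `v` of length `m` and then stays at `v`. -/
structure IsWalkSeq (G : SimpleGraph V) (p : ℕ → V) (u v : V) (m : ℕ) : Prop where
  zero : p 0 = u
  adj : ∀ i < m, G.Adj (p i) (p (i + 1))
  eq_of_le : ∀ i, m ≤ i → p i = v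

theorem IsWalkSeq.dist_add_le {p : ℕ → V} {u v : V} {m : ℕ} (hG : G.Connected)
    (hp : IsWalkSeq G p u v m) (i r : ℕ) : G.dist (p i) (p (i + r)) ≤ r := by
  induction r with
  | zero => simp
  | succ r ih =>
    rw [dist_le_succ_iff hG]
    by_cases h : i + r < m
    · exact .inr ⟨_, ih, hp.adj _ h⟩
    · refine .inl ?_
      rwa [hp.eq_of_le (i + (r + 1)) (by omega), ← hp.eq_of_le (i + r) (by omega)]

theorem IsWalkSeq.dist_le {p : ℕ → V} {u v : V} {m i j r : ℕ} (hG : G.Connected)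
    (hp : IsWalkSeq G p u v m) (hij : i ≤ j + r) (hji : j ≤ i + r) : G.dist (p i) (p j) ≤ r := by
  rcases le_total i j with h | h
  · obtain ⟨t, rfl⟩ := Nat.exists_eq_add_of_le h
    exact (hp.dist_add_le hG i t).trans (by omega)
  · obtain ⟨t, rfl⟩ := Nat.exists_eq_add_of_le h
    rw [SimpleGraph.dist_comm]
    exact (hp.dist_add_le hG j t).trans (by omega)

theorem PathDecomposition.dist_le_length (D : PathDecomposition G) {i : Fin D.numBags} {x y : V}
    (hx : x ∈ D.bag i) (hy : y ∈ D.bag i) : G.dist x y ≤ D.length :=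
  calc G.dist x y ≤ (D.bag i).sup fun y => G.dist x y := Finset.le_sup (f := fun y => G.dist x y) hy
    _ ≤ (D.bag i).sup fun x => (D.bag i).sup fun y => G.dist x y :=
      Finset.le_sup (f := fun x => (D.bag i).sup fun y => G.dist x y) hx
    _ ≤ D.length := Finset.le_sup (Finset.mem_univ i)
      (f := fun i => (D.bag i).sup fun x => (D.bag i).sup fun y => G.dist x y)

/-- The bags that contain a given vertex form an interval. -/
theorem PathDecomposition.exists_intervals (D : PathDecomposition G) :
    ∃ l r : V → Fin D.numBags, ∀ x i, x ∈ D.bag i ↔ l x ≤ i ∧ i ≤ r x := by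
  classical
  have : ∀ x, ∃ l r : Fin D.numBags, ∀ i, x ∈ D.bag i ↔ l ≤ i ∧ i ≤ r := by
    intro x
    have hmem : ∀ i, i ∈ Finset.univ.filter (fun i => x ∈ D.bag i) ↔ x ∈ D.bag i := by simp
    have hne := (D.vertex_mem x).imp fun i => (hmem i).2
    exact ⟨_, _, fun i => ⟨fun hi => ⟨Finset.min'_le _ i ((hmem i).2 hi),
      Finset.le_max' _ i ((hmem i).2 hi)⟩, fun hi => D.consecutive x _ i _ hi.1 hi.2
        ((hmem _).1 (Finset.min'_mem _ hne)) ((hmem _).1 (Finset.max'_mem _ hne))⟩⟩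
  choose l r h using this
  exact ⟨l, r, h⟩

/-- Either all vertices are close to each other, or there are two vertices such that every walk
between them comes close to all vertices, in its interior. -/
theorem PathDecomposition.exists_dominating_pair [Finite V] [Nonempty V]
    (D : PathDecomposition G) :
    (∀ x y, G.dist x y ≤ D.length) ∨
      ∃ u v, ∀ p m, IsWalkSeq G p u v m → ∀ x, ∃ j, 0 < j ∧ j < m ∧ G.dist (p j) x ≤ D.length := by
  obtain ⟨l, r, hlr⟩ := D.exists_intervals
  obtain ⟨u, hu⟩ := Finite.exists_min r
  obtain ⟨v, hv⟩ := Finite.exists_max l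
  -- Adjacent vertices share a bag, so neither interval can end before the other begins.
  have hedge : ∀ {x y}, G.Adj x y → l x ≤ r y := by
    intro x y h
    obtain ⟨i, hx, hy⟩ := D.edge_mem x y h
    exact ((hlr x i).1 hx).1.trans ((hlr y i).1 hy).2
  have hself : ∀ x, l x ≤ r x := by
    intro x
    obtain ⟨i, hx⟩ := D.vertex_mem x
    exact ((hlr x i).1 hx).1.trans ((hlr x i).1 hx).2
  -- In this case every x satisfies l x ≤ l v ≤ r u ≤ r x, so bag r u contains all vertices.
  -- Otherwise the bags of u precede those of v, which excludes walks of length 0 and 1.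
  by_cases hle : l v ≤ r u
  · exact .inl fun x y => D.dist_le_length (i := r u)
      ((hlr x _).2 ⟨(hv x).trans hle, hu x⟩) ((hlr y _).2 ⟨(hv y).trans hle, hu y⟩)
  rw [not_le] at hle
  refine .inr ⟨u, v, fun p m hp x => ?_⟩
  have hm0 : m ≠ 0 := by
    rintro rfl
    have : u = v := hp.zero.symm.trans (hp.eq_of_le 0 le_rfl)
    subst this
    exact absurd (hself u) (not_le.2 hle)
  have hm1 : m ≠ 1 := by
    rintro rfl
    have := hp.adj 0 one_pos
    rw [hp.zero, hp.eq_of_le _ le_rfl] at this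
    exact absurd (hedge this.symm) (not_le.2 hle)
  -- If x meets the last bag of u or the first bag of v, the second or the penultimate vertex of the
  -- walk shares that bag with x, and it is interior.
  have key : ∃ j i, 0 < j ∧ j < m ∧ p j ∈ D.bag i ∧ x ∈ D.bag i := by
    by_cases h₁ : l x ≤ r u
    · have := hp.adj 0 (by omega)
      rw [hp.zero] at this
      exact ⟨1, r u, one_pos, by omega, (hlr _ _).2 ⟨hedge this.symm, hu _⟩,
        (hlr _ _).2 ⟨h₁, hu x⟩⟩
    by_cases h₂ : l v ≤ r x
    · have := hp.adj (m - 1) (by omega)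
      rw [hp.eq_of_le (m - 1 + 1) (by omega)] at this
      exact ⟨m - 1, l v, by omega, by omega, (hlr _ _).2 ⟨hv _, hedge this.symm⟩,
        (hlr _ _).2 ⟨hv x, h₂⟩⟩
    rw [not_le] at h₁ h₂
    -- Otherwise take the first walk vertex whose interval does not end before bag l x. Its
    -- predecessor ends earlier, so by adjacency it starts before l x as well; hence it lies in bag
    -- l x together with x.
    have hex : ∃ j, l x ≤ r (p j) :=
      ⟨m, by rw [hp.eq_of_le m le_rfl]; exact (hself x).trans (h₂.le.trans (hself v))⟩
    classical
    have hj := Nat.find_spec hex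
    have hmin := fun {j} => Nat.find_min (m := j) hex
    generalize Nat.find hex = j at hj hmin
    have hj0 : j ≠ 0 := by
      rintro rfl
      rw [hp.zero] at hj
      exact absurd hj (not_le.2 h₁)
    have hprev := not_le.1 (hmin (show j - 1 < j by omega))
    have hjm : j - 1 < m := by
      by_contra hc
      rw [hp.eq_of_le _ (not_lt.1 hc)] at hprev
      exact absurd ((hself x).trans (h₂.le.trans (hself v))) (not_le.2 hprev)
    have hadj := hp.adj _ hjm
    rw [show j - 1 + 1 = j by omega] at hadj
    have hl : l (p j) ≤ l x := (hedge hadj.symm).trans hprev.le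
    refine ⟨j, l x, by omega, ?_, (hlr _ _).2 ⟨hl, hj⟩, (hlr _ _).2 ⟨le_rfl, hself x⟩⟩
    by_contra hc
    rw [hp.eq_of_le j (by omega)] at hl
    exact absurd (hl.trans (hself x)) (not_le.2 h₂)
  obtain ⟨j, i, h₁, h₂, hj, hx⟩ := key
  exact ⟨j, h₁, h₂, D.dist_le_length hj hx⟩

theorem exists_length_eq_pathLength (G : SimpleGraph V) [Finite V] :
    ∃ D : PathDecomposition G, D.length = pathLength G := by
  classical
  have := Fintype.ofFinite V
  exact Nat.sInf_mem (s := {l | ∃ D : PathDecomposition G, D.length = l})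
    ⟨_, ⟨1, fun _ => Finset.univ, fun _ => ⟨0, by simp⟩, fun _ _ _ => ⟨0, by simp⟩,
      fun _ _ _ _ _ _ _ _ => by simp⟩, rfl⟩

theorem pathLength_le_availableLength (D : Option (PathDecomposition G)) :
    pathLength G ≤ availableLength D := by
  cases D with
  | none => simp only [availableLength]; omega
  | some D => exact Nat.sInf_le ⟨D, rfl⟩

/-- A bag containing both ends of an edge has diameter at least 1. Positivity makes the
approximation bound strict. -/
theorem pathLength_pos [Finite V] {u v : V} (h : G.Adj u v) : 0 < pathLength G := by
  obtain ⟨D, hD⟩ := exists_length_eq_pathLength G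
  obtain ⟨i, hu, hv⟩ := D.edge_mem u v h
  rw [← hD, Nat.pos_iff_ne_zero]
  have := D.dist_le_length hu hv
  rw [SimpleGraph.dist_eq_one_iff_adj.2 h] at this
  omega

end Decompositions

/-! ### Burning along a walk -/

/-- The position of the activator of round `i` when a walk is burned in `s` rounds. -/
def centre (s : ℕ) : ℕ → ℕ
  | 0 => s
  | i + 1 => centre s i + ((s - 1 - i) + (s - 1 - i))

/-- With a = s-1-i the final radius of the fire of round i, its centre is s² - a² - a, so it covers
the positions from s² - a² - 2a to s² - a². These intervals tile 1, …, s². -/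
theorem centre_add {s : ℕ} : ∀ {i a : ℕ}, i + a + 1 = s → centre s i + a * a + a = s * s
  | 0, a, h => by subst h; simp only [centre]; ring
  | i + 1, a, h => by
    have := centre_add (s := s) (i := i) (a := a + 1) (by omega)
    rw [centre, show s - 1 - i = a + 1 by omega, ← this]
    ring

/-- Position j lies in the interval of radius a exactly when a² ≤ s² - j ≤ a² + 2a, that is, when a
is the integer square root of s² - j; j > 0 ensures a < s. -/
theorem exists_centre_near {s j : ℕ} (hj : 0 < j) (hjs : j ≤ s * s) :
    ∃ i r, i + r + 1 = s ∧ centre s i ≤ j + r ∧ j ≤ centre s i + r := by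
  have h₁ := Nat.sqrt_le (s * s - j)
  have h₂ := Nat.lt_succ_sqrt (s * s - j)
  set a := Nat.sqrt (s * s - j)
  have has : a < s := by
    by_contra hc
    have := Nat.mul_le_mul (not_lt.1 hc) (not_lt.1 hc)
    omega
  have h₃ := centre_add (s := s) (i := s - 1 - a) (a := a) (by omega)
  have h₄ : a.succ * a.succ = a * a + a + a + 1 := by simp only [Nat.succ_eq_add_one]; ring
  exact ⟨s - 1 - a, a, by omega, by omega, by omega⟩

/-- If all vertices are within distance `l` of the interior of a walk with at most `s * s`
interior vertices, then the graph burns in `s + l` rounds. -/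
theorem IsWalkSeq.burns {V : Type*} {G : SimpleGraph V} {p : ℕ → V} {u v : V} {m s l n : ℕ}
    (hG : G.Connected) (hp : IsWalkSeq G p u v m) (hms : m ≤ s * s + 1) (hmn : m ≤ n)
    (hl : ∀ x, ∃ j, 0 < j ∧ j < m ∧ G.dist (p j) x ≤ l) :
    Burns G (prefixList (fun i => p (min n (centre s i))) (s + l)) := by
  rw [burns_prefixList_iff hG]
  intro x
  obtain ⟨j, hj, hjm, hd⟩ := hl x
  obtain ⟨i, r, hir, h₁, h₂⟩ := exists_centre_near (s := s) hj (by omega)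
  refine ⟨i, r + l, by omega, ?_⟩
  -- Cutting the centre off at n is harmless, since j < m ≤ n. The l extra rounds enlarge the radius
  -- from r to r + l.
  have h₃ := hp.dist_le hG (i := min n (centre s i)) (j := j) (r := r) (by omega) (by omega)
  have := hG.dist_triangle (u := p (min n (centre s i))) (v := p j) (w := x)
  omega

variable {n : ℕ} {G : SimpleGraph (Fin n)}

/-! ### Simulation of the burning process -/

/-- Register `0` and table `0` hold the graph. -/
def Holds (G : SimpleGraph (Fin n)) (s : Store) : Prop :=
  s.reg 0 = n ∧ ∀ i j : Fin n, s.cell 0 i j ≠ 0 ↔ G.Adj i j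

theorem Holds.frame {R T : List ℕ} {s s' : Store} (h : Holds G s) (hf : Frame R T s s')
    (hR : 0 ∉ R) (hT : 0 ∉ T) : Holds G s' := by
  refine ⟨(hf.1 0 hR).trans h.1, fun i j => ?_⟩
  rw [hf.2 0 hT]
  exact h.2 i j

/-- The first column of table `a` starts with the first `n` entries of `f`. -/
def Column (a : ℕ) (s : Store) (f : ℕ → Fin n) : Prop := ∀ i < n, s.cell a i 0 = f i

namespace Cmd

/-- Compute row `i + 1` of table `b` from row `i` and the activator in row `i` of table `a`,
where `i` is the content of register `10`. -/
def burnRow (a b : ℕ) : Cmd :=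
  forN 11 (seq
    (setReg 13 (.add (.cell b (.reg 10) (.reg 11))
      (.eq (.cell a (.reg 10) (.const 0)) (.reg 11))))
    (seq
      (scan 12 (.and (.cell b (.reg 10) (.reg 12)) (.cell 0 (.reg 12) (.reg 11))) 13 (.const 1))
      (setCell b (.add (.reg 10) (.const 1)) (.reg 11) (.reg 13))))

/-- Simulate the burning process: row `i` of table `b` becomes the set that is burned after the
first `i` rounds of the schedule in the first column of table `a`. -/
def sim (a b : ℕ) : Cmd :=
  seq (forN 11 (setCell b (.const 0) (.reg 11) (.const 0))) (forN 10 (burnRow a b))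

theorem burnRow_spec {a b k : ℕ} {s : Store} (hs : Holds G s) (hb : b ≠ 0) (hab : a ≠ b)
    (hk : s.reg 10 = k) {c : Fin n} (hc : s.cell a k 0 = c) {B : Set (Fin n)}
    (hB : ∀ w : Fin n, s.cell b k w ≠ 0 ↔ w ∈ B) :
    (∀ w : Fin n, ((burnRow a b).exec s).cell b (k + 1) w ≠ 0 ↔ w ∈ burnRound G B c) ∧
      ∀ i ≤ k, ∀ w, ((burnRow a b).exec s).cell b i w = s.cell b i w := by
  have := forN_rule (x := 11) (s := s) (p := seq
    (setReg 13 (.add (.cell b (.reg 10) (.reg 11))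
      (.eq (.cell a (.reg 10) (.const 0)) (.reg 11))))
    (seq
      (scan 12 (.and (.cell b (.reg 10) (.reg 12)) (.cell 0 (.reg 12) (.reg 11))) 13 (.const 1))
      (setCell b (.add (.reg 10) (.const 1)) (.reg 11) (.reg 13))))
    (fun j s' => (∀ w : Fin n, (w : ℕ) < j → (s'.cell b (k + 1) w ≠ 0 ↔ w ∈ burnRound G B c)) ∧
      ∀ i ≤ k, ∀ w, s'.cell b i w = s.cell b i w) (by simp) ?_
  · rw [hs.1] at this
    exact ⟨fun w => this.1 w w.2, this.2⟩
  rintro j s' hj hx hf ⟨h₁, h₂⟩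
  rw [hs.1] at hj
  have hs' : Holds G s' :=
    hs.frame hf (by simp [regs, scan]) (by simpa [tabs, scan, eq_comm] using hb)
  have hk' : s'.reg 10 = k := (hf.1 10 (by simp [regs, scan])).trans hk
  have ha : s'.cell a = s.cell a := hf.2 a (by simpa [tabs, scan] using hab)
  obtain ⟨v, hv, hcase⟩ := scan_exec (x := 12) (r := 13)
    (e := .and (.cell b (.reg 10) (.reg 12)) (.cell 0 (.reg 12) (.reg 11))) (v := .const 1)
    (s := s'.setReg 13 (Expr.eval s' (.add (.cell b (.reg 10) (.reg 11))
      (.eq (.cell a (.reg 10) (.const 0)) (.reg 11)))))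
    (by decide) (fun _ _ => rfl) (fun _ _ => rfl)
  simp only [exec, hv]
  -- Only nonvanishing matters: an entry exceeds 1 if a burned vertex is activated again.
  have hvj : v ≠ 0 ↔ (⟨j, hj⟩ : Fin n) ∈ burnRound G B c := by
    have hB' : ∀ w : Fin n, s'.cell b k w ≠ 0 ↔ w ∈ B := fun w => by rw [h₂ k le_rfl, hB]
    simp only [burnRound, Set.mem_insert_iff, Set.mem_union, Set.mem_ofPred_eq]
    simp only [Expr.eval, Expr.eval_and_eq_zero, Store.setReg_reg, Store.setReg_cell, hx, hk',
      ha, hc, hs'.1, reduceIte, ne_eq, not_not, Nat.reduceEqDiff, OfNat.zero_ne_ofNat] at hcase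
    rcases hcase with ⟨i, hi, hadj, rfl⟩ | ⟨hall, rfl⟩
    · refine iff_of_true one_ne_zero (.inr (.inr ⟨⟨i, hi⟩, ?_, ?_⟩))
      · exact (hB' ⟨i, hi⟩).1 hadj.1
      · exact (hs'.2 ⟨i, hi⟩ ⟨j, hj⟩).1 hadj.2
    · rw [← hB' ⟨j, hj⟩]
      have hno : ¬∃ u ∈ B, G.Adj u ⟨j, hj⟩ := by
        rintro ⟨u, hu, hadj⟩
        exact hall u u.2 ⟨(hB' u).2 hu, (hs'.2 u ⟨j, hj⟩).2 hadj⟩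
      by_cases hcj : (c : ℕ) = j
      · simp [hcj, Fin.ext_iff]
      · simp [hcj, hno, Fin.ext_iff, Ne.symm hcj]
  refine ⟨fun w hw => ?_, fun i hi w => ?_⟩
  · simp only [Store.setReg_cell, Store.setCell_cell, Expr.eval, Store.setReg_reg, hk', hx,
      Nat.reduceEqDiff, reduceIte]
    by_cases hwj : (w : ℕ) = j
    · obtain rfl : w = ⟨j, hj⟩ := Fin.ext hwj
      simpa using hvj
    · simpa [hwj] using h₁ w (by omega)
  · simp only [Store.setReg_cell, Store.setCell_cell, Expr.eval, Store.setReg_reg, hk', hx,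
      Nat.reduceEqDiff, reduceIte]
    rw [if_neg (by omega)]
    exact h₂ i hi w

theorem sim_spec {a b : ℕ} {s : Store} (hs : Holds G s) (hb : b ≠ 0) (hab : a ≠ b)
    {f : ℕ → Fin n} (hf : Column a s f) {i : ℕ} (hi : i ≤ n) (w : Fin n) :
    ((sim a b).exec s).cell b i w ≠ 0 ↔ w ∈ burnedAfter G (prefixList f i) := by
  have h₀ : ∀ w < n, ((forN 11 (setCell b (.const 0) (.reg 11) (.const 0))).exec s).cell b 0 w
      = 0 := by
    have := forN_rule (x := 11) (s := s) (p := setCell b (.const 0) (.reg 11) (.const 0))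
      (fun k s' => ∀ w < k, s'.cell b 0 w = 0) (by simp) ?_
    · rwa [hs.1] at this
    intro k s' hk hx _ h w hw
    simp only [exec, Expr.eval, Store.setReg_cell, Store.setCell_cell, hx, true_and]
    split_ifs with hwk
    · rfl
    · exact h w (by omega)
  have hfr := (forN 11 (setCell b (.const 0) (.reg 11) (.const 0))).exec_frame s
  have heq : (sim a b).exec s = (forN 10 (burnRow a b)).exec
    ((forN 11 (setCell b (.const 0) (.reg 11) (.const 0))).exec s) := rfl
  rw [heq]
  generalize (forN 11 (setCell b (.const 0) (.reg 11) (.const 0))).exec s = s₁ at h₀ hfr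
  have hs₁ : Holds G s₁ := hs.frame hfr (by simp [regs]) (by simpa [tabs, eq_comm] using hb)
  have := forN_rule (x := 10) (s := s₁) (p := burnRow a b)
    (fun k s' => ∀ i ≤ k, ∀ w : Fin n,
      s'.cell b i w ≠ 0 ↔ w ∈ burnedAfter G (prefixList f i)) ?_ ?_
  · rw [hs₁.1] at this
    exact this i hi w
  · intro i hi w
    obtain rfl : i = 0 := by omega
    simp [h₀ w w.2, burnedAfter, prefixList]
  · intro k s' hk hx hf' h
    rw [hs₁.1] at hk
    have hs' : Holds G s' := hs₁.frame hf' (by simp [burnRow, regs, scan])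
      (by simpa [burnRow, tabs, scan, eq_comm] using hb)
    have hc : s'.cell a k 0 = f k := by
      rw [hf'.2 a (by simpa [burnRow, tabs, scan] using hab), hfr.2 a (by simpa [tabs] using hab)]
      exact hf k hk
    obtain ⟨g₁, g₂⟩ := burnRow_spec hs' hb hab hx hc (h k le_rfl)
    intro i hi w
    rcases Nat.le_succ_iff_eq_or_le.1 hi with rfl | hi
    · rw [Store.setReg_cell, g₁, burnedAfter_prefixList_succ]
    · rw [Store.setReg_cell, g₂ i hi, h i hi w]

end Cmd

/-! ### Recording the best schedule -/

/-- The memory holds the graph and, in the output, a burning schedule or nothing. -/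
def Ok (G : SimpleGraph (Fin n)) (s : Store) : Prop :=
  Holds G s ∧ (s.reg 2 ≠ 0 → ∃ σ : List (Fin n), Burns G σ ∧ s.Outputs σ)

/-- A schedule of at most `K` rounds is recorded. -/
def Found (s : Store) (K : ℕ) : Prop := s.reg 2 ≠ 0 ∧ s.reg 2 ≤ K

/-- The memory `s'` is in order, and its recorded schedule is no worse than that of `s`. -/
def Improves (G : SimpleGraph (Fin n)) (s s' : Store) : Prop :=
  Ok G s' ∧ ∀ K, Found s K → Found s' K

theorem Improves.trans {s₁ s₂ s₃ : Store} (h₁ : Improves G s₁ s₂) (h₂ : Improves G s₂ s₃) :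
    Improves G s₁ s₃ :=
  ⟨h₂.1, fun K h => h₂.2 K (h₁.2 K h)⟩

theorem Ok.frame {R T : List ℕ} {s s' : Store} (h : Ok G s) (hf : Frame R T s s')
    (hR : 0 ∉ R ∧ 2 ∉ R) (hT : 0 ∉ T ∧ 2 ∉ T) : Improves G s s' := by
  have h₁ := hf.1 2 hR.2
  have h₂ := hf.2 2 hT.2
  refine ⟨⟨h.1.frame hf hR.1 hT.1, fun h' => ?_⟩, fun K hK => ?_⟩
  · rw [h₁] at h'
    obtain ⟨σ, hσ, ho⟩ := h.2 h'
    refine ⟨σ, hσ, ?_⟩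
    unfold Store.Outputs
    rw [h₁, h₂]
    exact ho
  · unfold Found
    rw [h₁]
    exact hK

theorem setReg_frame (s : Store) (x v : ℕ) : Frame [x] [] s (s.setReg x v) := by
  refine ⟨fun r hr => ?_, fun _ _ => rfl⟩
  simp only [List.mem_singleton] at hr
  simp [hr]

/-- A command that keeps the memory in order and never makes the recorded schedule worse. -/
def Preserving (G : SimpleGraph (Fin n)) (p : Cmd) : Prop :=
  ∀ s, Ok G s → Improves G s (p.exec s)

namespace Cmd

theorem preserving_of_frame {p : Cmd} (hR : 0 ∉ p.regs ∧ 2 ∉ p.regs)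
    (hT : 0 ∉ p.tabs ∧ 2 ∉ p.tabs) : Preserving G p :=
  fun s h => h.frame (p.exec_frame s) hR hT

theorem preserving_seq {p q : Cmd} (hp : Preserving G p) (hq : Preserving G q) :
    Preserving G (seq p q) :=
  fun s h => (hp s h).trans (hq _ (hp s h).1)

theorem preserving_forN {x : ℕ} {p : Cmd} (hx : x ≠ 0 ∧ x ≠ 2) (hp : Preserving G p) :
    Preserving G (forN x p) := by
  have hset : ∀ {s : Store} {v : ℕ}, Ok G s → Improves G s (s.setReg x v) := fun h =>
    h.frame (setReg_frame _ _ _) (by simpa [eq_comm] using hx) (by simp)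
  intro s hs
  exact forN_rule (fun _ s' => Improves G s s') (hset hs)
    fun k s' _ _ _ h => h.trans ((hp s' h.1).trans (hset (hp s' h.1).1))

/-- Iteration k finds the schedule and later iterations cannot worsen the record. `J` is a property
of the tables that every iteration keeps and that iteration k relies on. -/
theorem found_forN {x k K : ℕ} {p : Cmd} {s : Store} (hx : x ≠ 0 ∧ x ≠ 2) (hp : Preserving G p)
    (hs : Ok G s) (hk : k < n) (J : (ℕ → ℕ → ℕ → ℕ) → Prop) (hJs : J s.cell)
    (hJ : ∀ s, J s.cell → J (p.exec s).cell)
    (hit : ∀ s', Ok G s' → s'.reg x = k → Frame (x :: p.regs) p.tabs s s' → J s'.cell →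
      Found (p.exec s') K) :
    Found ((forN x p).exec s) K := by
  have hset : ∀ {s : Store} {v : ℕ}, Ok G s → Improves G s (s.setReg x v) := fun h =>
    h.frame (setReg_frame _ _ _) (by simpa [eq_comm] using hx) (by simp)
  have := forN_rule (p := p) (s := s) (fun j s' => Ok G s' ∧ J s'.cell ∧ (k < j → Found s' K))
    ⟨(hset hs).1, hJs, by simp⟩ ?_
  · exact this.2.2 (by rwa [hs.1.1])
  rintro j s' - hj hf ⟨h, hJs', hlt⟩
  have h₁ := hp s' h
  refine ⟨(hset h₁.1).1, hJ s' hJs', fun hkj => (hset h₁.1).2 K ?_⟩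
  rcases Nat.lt_succ_iff_lt_or_eq.1 hkj with hkj | rfl
  · exact h₁.2 K (hlt hkj)
  · exact hit s' h hj hf hJs'

/-! ### Verification of candidate schedules -/

/-- Set register `15` to a nonzero value if the first column of table `3` consists of vertices
and all vertices are burned in row `k + 1` of table `4`, where `k` is the content of
register `14`. -/
def testPrefix : Cmd :=
  seq (setReg 15 (.const 1)) (seq
    (scan 16 (.eq (.lt (.cell 3 (.reg 16) (.const 0)) (.reg 0)) (.const 0)) 15 (.const 0))
    (scan 16 (.eq (.cell 4 (.add (.reg 14) (.const 1)) (.reg 16)) (.const 0)) 15 (.const 0)))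

/-- If the test has succeeded and the prefix of length `k + 1` of the first column of table `3` is
better than the recorded schedule, then record it. -/
def record : Cmd :=
  branch
    (.and (.reg 15)
      (.add (.eq (.reg 2) (.const 0)) (.lt (.add (.reg 14) (.const 1)) (.reg 2))))
    (seq (setReg 2 (.add (.reg 14) (.const 1)))
      (forN 17 (setCell 2 (.reg 17) (.const 0) (.cell 3 (.reg 17) (.const 0)))))
    skip

/-- Test all prefixes of the first column of table `3`, and record the best one. -/
def check : Cmd := seq (sim 3 4) (forN 14 (seq testPrefix record))

theorem testPrefix_spec {s : Store} :
    (testPrefix.exec s).reg 15 ≠ 0 ↔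
      (∀ i < s.reg 0, s.cell 3 i 0 < s.reg 0) ∧ ∀ w < s.reg 0, s.cell 4 (s.reg 14 + 1) w ≠ 0 := by
  obtain ⟨v, hv, hcase⟩ := scan_exec (x := 16) (r := 15)
    (e := .eq (.lt (.cell 3 (.reg 16) (.const 0)) (.reg 0)) (.const 0)) (v := .const 0)
    (s := s.setReg 15 1)
    (by decide) (fun _ _ => rfl) (fun _ _ => rfl)
  obtain ⟨v', hv', hcase'⟩ := scan_exec (x := 16) (r := 15)
    (e := .eq (.cell 4 (.add (.reg 14) (.const 1)) (.reg 16)) (.const 0)) (v := .const 0)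
    (s := ((s.setReg 15 1).setReg 15 v).setReg 16 (s.reg 0))
    (by decide) (fun _ _ => rfl) (fun _ _ => rfl)
  simp only [Store.setReg_reg, OfNat.zero_ne_ofNat, reduceIte] at hv hv'
  simp only [testPrefix, exec, Expr.eval, hv, hv']
  simp only [Expr.eval, Store.setReg_reg, Store.setReg_cell, OfNat.zero_ne_ofNat,
    Nat.reduceEqDiff, reduceIte, ite_eq_right_iff, one_ne_zero, imp_false, ne_eq, not_not] at hcase hcase' ⊢
  grind

theorem record_spec {s : Store} (hs : Ok G s) {k : ℕ} (hk : s.reg 14 = k) (hkn : k < n)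
    (h : s.reg 15 ≠ 0 → ∃ f : ℕ → Fin n, Column 3 s f ∧ Burns G (prefixList f (k + 1))) :
    Improves G s (record.exec s) ∧ (s.reg 15 ≠ 0 → Found (record.exec s) (k + 1)) := by
  by_cases h15 : s.reg 15 = 0
  · have : record.exec s = s := by simp [record, exec, Expr.eval, h15]
    rw [this]
    exact ⟨⟨hs, fun _ => id⟩, fun h => absurd h15 h⟩
  by_cases hbest : s.reg 2 = 0 ∨ k + 1 < s.reg 2
  · obtain ⟨f, hf, hb⟩ := h h15
    have hexec : record.exec s =
        (forN 17 (setCell 2 (.reg 17) (.const 0) (.cell 3 (.reg 17) (.const 0)))).exec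
          (s.setReg 2 (k + 1)) := by
      rw [record, exec, if_pos]
      · simp [exec, Expr.eval, hk]
      · rcases hbest with h | h <;> simp [Expr.eval, h15, hk, h]
    have hcopy := forN_rule (x := 17) (s := s.setReg 2 (k + 1))
      (p := setCell 2 (.reg 17) (.const 0) (.cell 3 (.reg 17) (.const 0)))
      (fun j s' => ∀ i < j, s'.cell 2 i 0 = s.cell 3 i 0) (by simp) (by
        intro j s' _ hx hfr h i hi
        have h3 : s'.cell 3 = s.cell 3 := hfr.2 3 (by simp [tabs])
        simp only [exec, Expr.eval, Store.setReg_cell, Store.setCell_cell, hx, h3]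
        by_cases hij : i = j
        · simp [hij]
        · simpa [hij] using h i (by omega))
    have hfr := (forN 17 (setCell 2 (.reg 17) (.const 0)
      (.cell 3 (.reg 17) (.const 0)))).exec_frame (s.setReg 2 (k + 1))
    rw [← hexec] at hcopy hfr
    have h2 : (record.exec s).reg 2 = k + 1 := by
      rw [hfr.1 2 (by simp [regs])]; simp
    have h0 : (s.setReg 2 (k + 1)).reg 0 = n := by simp [hs.1.1]
    rw [h0] at hcopy
    refine ⟨⟨⟨?_, fun _ => ⟨_, hb, ?_, fun i hi => ?_⟩⟩, fun K hK => ?_⟩, fun _ => ?_⟩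
    · exact (hs.1.frame (setReg_frame s 2 (k + 1)) (by simp) (by simp)).frame hfr
        (by simp [regs]) (by simp [tabs])
    · simpa using h2
    · rw [length_prefixList] at hi
      rw [hcopy i (by omega), hf i (by omega)]
      simp [prefixList]
    · have h₁ := hK.1
      have h₂ := hK.2
      exact ⟨by omega, by omega⟩
    · exact ⟨by omega, by omega⟩
  · have : record.exec s = s := by
      simp only [not_or, not_lt] at hbest
      have : ¬(k + 1 < s.reg 2) := by omega
      simp [record, exec, Expr.eval, hbest.1, this, hk]
    rw [this]
    exact ⟨⟨hs, fun _ => id⟩, fun _ => ⟨by omega, by omega⟩⟩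

/-- Soundness and completeness of the test. Soundness assumes nothing about how the candidate in
table `3` arose, so the searches need not be correct in every iteration. -/
theorem check_spec {s : Store} (hs : Ok G s) :
    Improves G s (check.exec s) ∧ ∀ f : ℕ → Fin n, Column 3 s f → ∀ K, 0 < K → K ≤ n →
      Burns G (prefixList f K) → Found (check.exec s) K := by
  have hsim := hs.frame ((sim 3 4).exec_frame s) (by simp [sim, burnRow, regs, scan])
    (by simp [sim, burnRow, tabs, scan])
  have h3 : ((sim 3 4).exec s).cell 3 = s.cell 3 :=
    ((sim 3 4).exec_frame s).2 3 (by simp [sim, burnRow, tabs, scan])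
  have hrow := fun f hf i hi w => sim_spec (a := 3) (b := 4) hs.1 (by decide) (by decide)
    (f := f) hf (i := i) hi w
  have heq : check.exec s = (forN 14 (seq testPrefix record)).exec ((sim 3 4).exec s) := rfl
  rw [heq]
  generalize (sim 3 4).exec s = s₁ at hsim h3 hrow
  have := forN_rule (x := 14) (s := s₁) (p := seq testPrefix record)
    (fun k s' => Improves G s s' ∧ ∀ f : ℕ → Fin n, Column 3 s f → ∀ K, 0 < K → K ≤ k →
      Burns G (prefixList f K) → Found s' K) ?_ ?_
  · rwa [hsim.1.1.1] at this
  · exact ⟨hsim.trans (hsim.1.frame (setReg_frame _ _ _) (by simp) (by simp)), by omega⟩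
  rintro k s' hk hx hf ⟨himp, hfound⟩
  rw [hsim.1.1.1] at hk
  have hfr := testPrefix.exec_frame s'
  have htest := testPrefix_spec (s := s')
  have h4' : s'.cell 4 = s₁.cell 4 := hf.2 4 (by simp [testPrefix, record, tabs, scan])
  have h3' : s'.cell 3 = s.cell 3 :=
    (hf.2 3 (by simp [testPrefix, record, tabs, scan])).trans h3
  have himp₂ := himp.1.frame hfr (by simp [testPrefix, regs, scan])
    (by simp [testPrefix, tabs, scan])
  have h14 : (testPrefix.exec s').reg 14 = k :=
    (hfr.1 14 (by simp [testPrefix, regs, scan])).trans hx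
  have h3'' : (testPrefix.exec s').cell 3 = s.cell 3 :=
    (hfr.2 3 (by simp [testPrefix, tabs, scan])).trans h3'
  rw [himp.1.1.1, h3', h4', hx] at htest
  have heq : (seq testPrefix record).exec s' = record.exec (testPrefix.exec s') := rfl
  rw [heq]
  generalize testPrefix.exec s' = s₂ at htest himp₂ h14 h3''
  obtain ⟨hrec, hfd⟩ := record_spec himp₂.1 h14 hk (by
    intro h15
    obtain ⟨hval, hall⟩ := htest.1 h15
    have : Nonempty (Fin n) := ⟨⟨k, hk⟩⟩
    -- The default beyond the n entries of the column is never used, as k + 1 ≤ n.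
    refine ⟨fun i => if hi : i < n then ⟨s.cell 3 i 0, hval i hi⟩ else ⟨k, hk⟩, ?_, ?_⟩
    · intro i hi
      simp [h3'', hi]
    · refine Set.eq_univ_of_forall fun w => ?_
      rw [← hrow _ _ (k + 1) (by omega) w]
      · exact hall w w.2
      · intro i hi
        simp [hi])
  have himp₃ := himp.trans (himp₂.trans (hrec.trans
    (hrec.1.frame (setReg_frame _ 14 (k + 1)) (by simp) (by simp))))
  refine ⟨himp₃, fun f hf K h0 hK hB => ?_⟩
  rcases Nat.le_succ_iff_eq_or_le.1 hK with rfl | hK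
  · refine (hrec.1.frame (setReg_frame _ 14 (k + 1)) (by simp) (by simp)).2 _ (hfd ?_)
    refine htest.2 ⟨fun i hi => by rw [hf i hi]; exact (f i).2, fun w hw => ?_⟩
    rw [hrow f hf (k + 1) (by omega) ⟨w, hw⟩]
    rw [hB]
    trivial
  · exact (himp₂.trans (hrec.trans
      (hrec.1.frame (setReg_frame _ 14 (k + 1)) (by simp) (by simp)))).2 _ (hfound f hf K h0 hK hB)

theorem check_preserving : Preserving G check := fun _ h => (check_spec h).1

theorem check_regs : check.regs = [11, 10, 11, 13, 12, 13, 14, 15, 16, 15, 16, 15, 2, 17] := rfl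

theorem check_tabs : check.tabs = [4, 4, 2] := rfl

theorem check_wf : check.WF := by
  simp [check, sim, burnRow, testPrefix, record, scan, WF, regs]

/-! ### Exhaustive search -/

/-- Fill the first column of table `a` with the values of `e`, as a function of register `20`. -/
def fill (a : ℕ) (e : Expr) : Cmd := forN 20 (setCell a (.reg 20) (.const 0) e)

/-- Check all ways to overwrite the first `k` entries of the first column of table `3`. -/
def brute : ℕ → Cmd
  | 0 => check
  | k + 1 => forN (100 + k) (seq (setCell 3 (.const k) (.const 0) (.reg (100 + k))) (brute k))

/-- The nested loops use pairwise distinct registers from 100 on, above all those of `check`. -/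
theorem brute_regs {k r : ℕ} (hr : r ∈ (brute k).regs) :
    r ∈ check.regs ∨ 100 ≤ r ∧ r < 100 + k := by
  induction k with
  | zero => exact .inl hr
  | succ k ih =>
    simp only [brute, regs, List.nil_append, List.mem_cons] at hr
    rcases hr with rfl | hr
    · exact .inr (by omega)
    · exact (ih hr).imp_right fun h => by omega

theorem brute_wf (k : ℕ) : (brute k).WF := by
  induction k with
  | zero => exact check_wf
  | succ k ih =>
    refine ⟨by omega, fun h => ?_, trivial, ih⟩
    simp only [regs, List.nil_append] at h
    rcases brute_regs h with h | h
    · have : ∀ r ∈ check.regs, r < 100 := by simp [check_regs]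
      have := this _ h
      omega
    · omega

theorem brute_preserving (k : ℕ) : Preserving G (brute k) := by
  induction k with
  | zero => exact check_preserving
  | succ k ih =>
    exact preserving_forN (by omega)
      (preserving_seq (preserving_of_frame (by simp [regs]) (by simp [tabs])) ih)

theorem brute_cell {k i : ℕ} (hi : k ≤ i) (s : Store) :
    ((brute k).exec s).cell 3 i 0 = s.cell 3 i 0 := by
  induction k generalizing s with
  | zero => rw [(exec_frame _ s).2 3 (by simp [brute, check_tabs])]
  | succ k ih =>
    refine forN_rule (fun _ s' => s'.cell 3 i 0 = s.cell 3 i 0) rfl fun j s' _ _ _ h => ?_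
    rw [Store.setReg_cell, exec, ih (by omega), exec, Store.setCell_cell, if_neg, h]
    simp only [Expr.eval]
    omega

/-- Induction on k: in the outer iteration whose counter equals f k, the entry at k agrees with f as
well, so one fewer entry remains to be guessed. -/
theorem found_brute {k K : ℕ} {s : Store} {f : ℕ → Fin n} (hs : Ok G s)
    (hf : ∀ i, k ≤ i → i < n → s.cell 3 i 0 = f i) (hK : 0 < K) (hKn : K ≤ n)
    (hB : Burns G (prefixList f K)) : Found ((brute k).exec s) K := by
  induction k generalizing s with
  | zero => exact (check_spec hs).2 f (fun i hi => hf i (by omega) hi) K hK hKn hB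
  | succ k ih =>
    have hpre : Preserving G (setCell 3 (.const k) (.const 0) (.reg (100 + k))) :=
      preserving_of_frame (by simp [regs]) (by simp [tabs])
    have hcell : ∀ (s : Store) i, k + 1 ≤ i → ((setCell 3 (.const k) (.const 0)
        (.reg (100 + k))).exec s).cell 3 i 0 = s.cell 3 i 0 := fun s i hi => by
      rw [exec, Store.setCell_cell, if_neg]
      simp only [Expr.eval]
      omega
    refine found_forN (by omega) (preserving_seq hpre (brute_preserving k)) hs (f k).2
      (fun t => ∀ i, k + 1 ≤ i → i < n → t 3 i 0 = f i) hf ?_ ?_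
    · intro s h i hi hin
      rw [exec, brute_cell (by omega), hcell s i hi, h i hi hin]
    · intro s' hok hr _ h
      refine ih (hpre s' hok).1 fun i hi hin => ?_
      rcases Nat.eq_or_lt_of_le hi with rfl | hi
      · simp [exec, Store.setCell_cell, Expr.eval, hr]
      · rw [hcell s' i hi, h i hi hin]

theorem fill_spec {a : ℕ} {e : Expr} {s : Store} (hs : s.reg 0 = n) {f : ℕ → Fin n}
    (he : ∀ i < n, ∀ s', s'.reg 20 = i → (∀ r, r ≠ 20 → s'.reg r = s.reg r) → e.eval s' = f i) :
    Column a ((fill a e).exec s) f := by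
  have := forN_rule (x := 20) (s := s) (p := setCell a (.reg 20) (.const 0) e)
    (fun k s' => ∀ i < k, s'.cell a i 0 = f i) (by simp) ?_
  · rwa [hs] at this
  intro k s' hk hx hf h i hi
  rw [hs] at hk
  simp only [exec, Expr.eval, Store.setReg_cell, Store.setCell_cell, hx, true_and, and_true]
  split_ifs with hik
  · rw [he k hk s' hx fun r hr => hf.1 r (by simp [regs, hr]), hik]
  · exact h i (by omega)

/-! ### Search for a good walk -/

/-- Compute a shortest path in the first column of table `5`, where register `22` holds its start
and register `23` its length, and row `t` of table `6` is the ball of radius `t - 1` about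
its end. -/
def walk : Cmd :=
  seq (setCell 5 (.const 0) (.const 0) (.reg 22)) (forN 25 (seq
    (setReg 26 (.cell 5 (.reg 25) (.const 0)))
    (seq
      (scan 27 (.and (.cell 0 (.cell 5 (.reg 25) (.const 0)) (.reg 27))
        (.cell 6 (.sub (.reg 23) (.reg 25)) (.reg 27))) 26 (.reg 27))
      (setCell 5 (.add (.reg 25) (.const 1)) (.const 0) (.reg 26)))))

/-- Place the activators of a schedule along the path in table `5`, for `s` rounds, where register
`24` holds `s - 1`. -/
def place : Cmd :=
  seq (setReg 28 (.add (.reg 24) (.const 1))) (forN 29 (seq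
    (setCell 3 (.reg 29) (.const 0) (.cell 5 (.sub (.reg 0) (.sub (.reg 0) (.reg 28))) (.const 0)))
    (setReg 28 (.add (.reg 28) (.add (.sub (.reg 24) (.reg 29)) (.sub (.reg 24) (.reg 29)))))))

/-- Check the schedules along shortest paths between all pairs of vertices. -/
def paths : Cmd :=
  forN 21 (seq (fill 7 (.reg 21)) (seq (sim 7 6)
    (forN 22 (forN 23 (seq walk (forN 24 (seq place check)))))))

/-- Greedy descent: from the j-th vertex, at distance m - j from v, move to a neighbour in row m -
j, the ball of radius m - j - 1. For j ≥ m that row is row 0, which is empty, so the walk rests at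
v. -/
theorem walk_spec (hG : G.Connected) {s : Store} {u v : Fin n} (hs : Holds G s)
    (hu : s.reg 22 = u) (hm : s.reg 23 = G.dist v u) (hmn : G.dist v u < n)
    (h6 : ∀ t ≤ n, ∀ w : Fin n, s.cell 6 t w ≠ 0 ↔ G.dist v w + 1 ≤ t) :
    ∃ p, IsWalkSeq G p u v (G.dist v u) ∧ ∀ i ≤ n, (walk.exec s).cell 5 i 0 = p i := by
  set m := G.dist v u with hmdef
  have := forN_rule (x := 25) (s := (setCell 5 (.const 0) (.const 0) (.reg 22)).exec s) (p := seq
    (setReg 26 (.cell 5 (.reg 25) (.const 0)))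
    (seq
      (scan 27 (.and (.cell 0 (.cell 5 (.reg 25) (.const 0)) (.reg 27))
        (.cell 6 (.sub (.reg 23) (.reg 25)) (.reg 27))) 26 (.reg 27))
      (setCell 5 (.add (.reg 25) (.const 1)) (.const 0) (.reg 26))))
    (fun j s' => ∃ p : ℕ → Fin n, p 0 = u ∧ (∀ i, j ≤ i → p i = p j) ∧
      (∀ i < j, i < m → G.Adj (p i) (p (i + 1))) ∧ (∀ i ≤ j, G.dist v (p i) = m - i) ∧
      ∀ i ≤ j, s'.cell 5 i 0 = p i) ?_ ?_
  · have h0 : ((setCell 5 (.const 0) (.const 0) (.reg 22)).exec s).reg 0 = n := hs.1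
    rw [h0] at this
    obtain ⟨p, h₀, hconst, hadj, hdist, hcell⟩ := this
    refine ⟨p, ⟨h₀, fun i hi => hadj i (by omega) hi, fun i hi => ?_⟩, hcell⟩
    rcases le_total i n with hin | hin
    · exact (hG.dist_eq_zero_iff.1 (by rw [hdist i hin]; omega)).symm
    · rw [hconst i hin]
      exact (hG.dist_eq_zero_iff.1 (by rw [hdist n le_rfl]; omega)).symm
  · refine ⟨fun _ => u, rfl, fun _ _ => rfl, by simp, fun i hi => ?_, fun i hi => ?_⟩
    · obtain rfl : i = 0 := by omega
      rfl
    · obtain rfl : i = 0 := by omega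
      simp [exec, Store.setCell_cell, Expr.eval, hu]
  rintro j s' hj hx hf ⟨p, h₀, hconst, hadj, hdist, hcell⟩
  replace hj : j < n := by simpa [exec, hs.1] using hj
  have hs' : Holds G s' := (hs.frame (exec_frame _ s) (by simp [regs]) (by simp [tabs])).frame hf
    (by simp [regs, scan]) (by simp [tabs, scan])
  have h23 : s'.reg 23 = m := (hf.1 23 (by simp [regs, scan])).trans hm
  have h6' : s'.cell 6 = s.cell 6 := (hf.2 6 (by simp [tabs, scan])).trans
    ((exec_frame _ s).2 6 (by simp [tabs]))
  have hpj := hcell j le_rfl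
  obtain ⟨x, hx', hcase⟩ := scan_exec (x := 27) (r := 26)
    (e := .and (.cell 0 (.cell 5 (.reg 25) (.const 0)) (.reg 27))
        (.cell 6 (.sub (.reg 23) (.reg 25)) (.reg 27))) (v := .reg 27)
    (s := s'.setReg 26 (p j)) (by decide) (fun _ _ => rfl) (fun _ _ => rfl)
  have hexec : (seq (setReg 26 (.cell 5 (.reg 25) (.const 0)))
      (seq
        (scan 27 (.and (.cell 0 (.cell 5 (.reg 25) (.const 0)) (.reg 27))
          (.cell 6 (.sub (.reg 23) (.reg 25)) (.reg 27))) 26 (.reg 27))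
        (setCell 5 (.add (.reg 25) (.const 1)) (.const 0) (.reg 26)))).exec s' =
      (((s'.setReg 26 (p j)).setReg 26 x).setReg 27 n).setCell 5 (j + 1) 0 x := by
    simp only [exec, Expr.eval, hx, hpj, hx']
    simp [hs'.1, hx]
  have hbdd : ∀ w : Fin n, s.cell 6 (m - j) w ≠ 0 ↔ G.dist v w + 1 ≤ m - j :=
    h6 (m - j) (by omega)
  have hnext : ∃ y : Fin n, x = y ∧ (j < m → G.Adj (p j) y) ∧ G.dist v y = m - (j + 1) := by
    simp only [Expr.eval, Expr.eval_and_eq_zero, Store.setReg_reg, Store.setReg_cell, hx, h23,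
      hpj, h6', hs'.1, reduceIte, ne_eq, not_not, Nat.reduceEqDiff, OfNat.zero_ne_ofNat] at hcase
    have hdj := hdist j le_rfl
    rcases hcase with ⟨i, hi, ⟨h₁, h₂⟩, hxi⟩ | ⟨hall, rfl⟩
    · have h₁ := (hs'.2 (p j) ⟨i, hi⟩).1 h₁
      have h₂ := (hbdd ⟨i, hi⟩).1 h₂
      refine ⟨⟨i, hi⟩, hxi, fun _ => h₁, ?_⟩
      have := hG.dist_triangle (u := v) (v := ⟨i, hi⟩) (w := p j)
      rw [SimpleGraph.dist_eq_one_iff_adj.2 h₁.symm] at this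
      omega
    -- The scan can fail only at v: before that, the next vertex of a geodesic would pass the test.
    · have hjm : m ≤ j := by
        by_contra hc
        obtain ⟨r, hr⟩ : ∃ r, m - j = r + 1 := ⟨m - j - 1, by omega⟩
        rcases (dist_le_succ_iff hG).1 (show G.dist v (p j) ≤ r + 1 by omega) with h | ⟨w, hw, ha⟩
        · omega
        · exact hall w w.2 ⟨(hs'.2 _ _).2 ha.symm, (hbdd w).2 (by omega)⟩
      exact ⟨p j, rfl, by omega, by omega⟩
  obtain ⟨y, rfl, hy, hdy⟩ := hnext
  refine ⟨fun i => if i ≤ j then p i else y, by simp [h₀], fun i hi => ?_, fun i hi him => ?_,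
    fun i hi => ?_, fun i hi => ?_⟩
  · simp [show ¬i ≤ j by omega]
  · rcases Nat.lt_succ_iff_lt_or_eq.1 hi with hi | rfl
    · simpa [show i ≤ j by omega, show i + 1 ≤ j by omega] using hadj i hi him
    · simpa using hy him
  · rcases Nat.le_succ_iff_eq_or_le.1 hi with rfl | hi
    · simpa using hdy
    · simpa [hi] using hdist i hi
  · rw [hexec, Store.setReg_cell, Store.setCell_cell]
    rcases Nat.le_succ_iff_eq_or_le.1 hi with rfl | hi
    · simp
    · simpa [hi, show i ≠ j + 1 by omega] using hcell i hi

theorem place_spec {s : Store} (hs : Holds G s) {p : ℕ → Fin n} {t : ℕ} (ht : s.reg 24 + 1 = t)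
    (hp : ∀ i ≤ n, s.cell 5 i 0 = p i) :
    Column 3 (place.exec s) fun i => p (min n (centre t i)) := by
  have := forN_rule (x := 29) (s := (setReg 28 (.add (.reg 24) (.const 1))).exec s) (p := seq
    (setCell 3 (.reg 29) (.const 0) (.cell 5 (.sub (.reg 0) (.sub (.reg 0) (.reg 28))) (.const 0)))
    (setReg 28 (.add (.reg 28) (.add (.sub (.reg 24) (.reg 29)) (.sub (.reg 24) (.reg 29))))))
    (fun k s' => s'.reg 28 = centre t k ∧ ∀ i < k, s'.cell 3 i 0 = p (min n (centre t i))) ?_ ?_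
  · have h0 : ((setReg 28 (.add (.reg 24) (.const 1))).exec s).reg 0 = n := by simp [exec, hs.1]
    rw [h0] at this
    exact this.2
  · simpa [exec, Expr.eval, centre] using ht
  · rintro k s' - hx hf ⟨h28, hcell⟩
    have h0 : s'.reg 0 = n := (hf.1 0 (by simp [regs])).trans (by simp [exec, hs.1])
    have h24 : s'.reg 24 = s.reg 24 := (hf.1 24 (by simp [regs])).trans (by simp [exec])
    have h5 : s'.cell 5 = s.cell 5 := hf.2 5 (by simp [tabs])
    refine ⟨?_, fun i hi => ?_⟩
    · simp only [exec, Expr.eval, Store.setReg_reg, Store.setCell_reg, hx, h28, h24,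
        Nat.reduceEqDiff, reduceIte, centre]
      omega
    · simp only [exec, Expr.eval, Store.setReg_cell, Store.setCell_cell, hx, h28, h0, h5]
      by_cases hik : i = k
      · subst hik
        -- The double truncated subtraction computes the minimum, which keeps the index among the
        -- computed entries 0, …, n of the walk.
        simp [show n - (n - centre t i) = min n (centre t i) by omega, hp]
      · simpa [hik] using hcell i (by omega)

theorem paths_wf : paths.WF := by
  simp [paths, walk, place, fill, check, sim, burnRow, testPrefix, record, scan, WF, regs]

theorem place_check_preserving : Preserving G (seq place check) :=
  preserving_seq (preserving_of_frame (by simp [place, regs]) (by simp [place, tabs]))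
    check_preserving

theorem walk_place_check_preserving : Preserving G (seq walk (forN 24 (seq place check))) :=
  preserving_seq (preserving_of_frame (by simp [walk, scan, regs]) (by simp [walk, scan, tabs]))
    (preserving_forN (by omega) place_check_preserving)

theorem fill_preserving {a : ℕ} {e : Expr} (ha : a ≠ 0 ∧ a ≠ 2) : Preserving G (fill a e) :=
  preserving_of_frame (by simp [fill, regs]) (by simpa [fill, tabs, eq_comm] using ha)

theorem sim_preserving {a b : ℕ} (hb : b ≠ 0 ∧ b ≠ 2) : Preserving G (sim a b) :=
  preserving_of_frame (by simp [sim, burnRow, scan, regs])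
    (by simpa [sim, burnRow, scan, tabs, eq_comm] using hb)

theorem paths_preserving : Preserving G paths :=
  preserving_forN (by omega) (preserving_seq (fill_preserving (by omega))
    (preserving_seq (sim_preserving (by omega)) (preserving_forN (by omega)
      (preserving_forN (by omega) walk_place_check_preserving))))

/-- The loops guess v, u, the length and t - 1. Only the guess that equals the distance from v to u
is used; wrong lengths do no harm because `check` verifies every candidate. -/
theorem found_paths (hG : G.Connected) {s : Store} (hs : Ok G s) {t K : ℕ} (ht : 0 < t)
    (htn : t ≤ n) (hK : 0 < K) (hKn : K ≤ n) (u v : Fin n) (huv : G.dist v u < n)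
    (hB : ∀ p, IsWalkSeq G p u v (G.dist v u) →
      Burns G (prefixList (fun i => p (min n (centre t i))) K)) :
    Found (paths.exec s) K := by
  refine found_forN (by omega) (preserving_seq (fill_preserving (by omega))
    (preserving_seq (sim_preserving (by omega)) (preserving_forN (by omega)
      (preserving_forN (by omega) walk_place_check_preserving)))) hs v.2
      (fun _ => True) trivial (fun _ _ => trivial) ?_
  rintro s₁ hs₁ hv - -
  have hcol := fill_spec (a := 7) (e := .reg 21) hs₁.1.1 (f := fun _ => v)
    (fun i _ s' _ h => by rw [Expr.eval, h 21 (by decide), hv])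
  have hs₂ := (fill_preserving (a := 7) (e := .reg 21) (by omega) s₁ hs₁).1
  simp only [exec_seq]
  generalize (fill 7 (.reg 21)).exec s₁ = s₂ at hcol hs₂
  -- With v activated in every round, the first fire contains all others and has radius t - 1 after
  -- t rounds.
  have hball : ∀ t ≤ n, ∀ w : Fin n,
      ((sim 7 6).exec s₂).cell 6 t w ≠ 0 ↔ G.dist v w + 1 ≤ t := by
    intro t ht w
    rw [sim_spec hs₂.1 (by decide) (by decide) hcol ht w, mem_burnedAfter_iff hG]
    exact ⟨fun ⟨i, r, h, hd⟩ => by omega, fun h => ⟨0, t - 1, by omega, by omega⟩⟩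
  have hs₃ := (sim_preserving (a := 7) (b := 6) (by omega) s₂ hs₂).1
  generalize (sim 7 6).exec s₂ = s₃ at hball hs₃
  refine found_forN (by omega) (preserving_forN (by omega) walk_place_check_preserving) hs₃ u.2
    (fun _ => True) trivial (fun _ _ => trivial) ?_
  rintro s₄ hs₄ hu hf₄ -
  rw [← hf₄.2 6 (by simp [tabs, walk, place, scan, check_tabs])] at hball
  refine found_forN (by omega) walk_place_check_preserving hs₄ huv
    (fun _ => True) trivial (fun _ _ => trivial) ?_
  rintro s₅ hs₅ hm hf₅ -
  rw [← hf₅.2 6 (by simp [tabs, walk, place, scan, check_tabs])] at hball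
  rw [← hf₅.1 22 (by simp [regs, walk, place, scan, check_regs])] at hu
  obtain ⟨p, hp, hcell⟩ := walk_spec hG hs₅.1 hu hm huv hball
  have hs₆ := (preserving_of_frame (G := G) (p := walk) (by simp [walk, scan, regs])
    (by simp [walk, scan, tabs]) s₅ hs₅).1
  simp only [exec_seq]
  generalize walk.exec s₅ = s₆ at hcell hs₆
  refine found_forN (k := t - 1) (by omega) place_check_preserving hs₆ (by omega)
    (fun _ => True) trivial (fun _ _ => trivial) ?_
  rintro s₇ hs₇ ht' hf₇ -
  rw [← hf₇.2 5 (by simp [tabs, place, check_tabs])] at hcell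
  have hs₈ := (preserving_of_frame (G := G) (p := place) (by simp [place, regs])
    (by simp [place, tabs]) s₇ hs₇).1
  exact (check_spec hs₈).2 _ (place_spec hs₇.1 (by omega) hcell) K hK hKn (hB p hp)

end Cmd
/-! ### The algorithm -/

theorem inputStore_ok (G : SimpleGraph (Fin n)) (D : Option (PathDecomposition G)) :
    Ok G (inputStore G D) := by
  refine ⟨⟨by simp [inputStore], fun i j => ?_⟩, fun h => absurd (by simp [inputStore]) h⟩
  simp [inputStore]

/-- The algorithm: record the best schedule among the enumeration of all vertices, the schedules
that differ from it only in the first `c + 1` rounds, and the schedules along shortest paths. -/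
def algorithm (c : ℕ) : Cmd :=
  .seq (.fill 3 (.reg 20)) (.seq .check (.seq (.brute (c + 1)) .paths))

theorem algorithm_wf (c : ℕ) : (algorithm c).WF :=
  ⟨by simp [Cmd.fill, Cmd.WF, Cmd.regs], Cmd.check_wf, Cmd.brute_wf _, Cmd.paths_wf⟩

/-- The enumeration of all vertices. -/
def enumeration (n : ℕ) [NeZero n] (i : ℕ) : Fin n := Fin.ofNat n i

/-- Each vertex is activated in its own round. This schedule guarantees a record and covers all
bounds that exceed n. -/
theorem burns_enumeration [NeZero n] (hG : G.Connected) :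
    Burns G (prefixList (enumeration n) n) := by
  rw [burns_prefixList_iff hG]
  exact fun v => ⟨v, n - 1 - v, by omega, by simp [enumeration]⟩

theorem dist_lt_card (hG : G.Connected) (u v : Fin n) : G.dist u v < n := by
  obtain ⟨p, hp, hlen⟩ := hG.exists_path_of_dist u v
  simpa [← hlen] using hp.length_lt

theorem burningNumber_pos {V : Type*} [Finite V] {G : SimpleGraph V} (hG : G.Connected) :
    0 < burningNumber G := by
  obtain ⟨s, hs, hB⟩ := exists_burns_length_eq hG
  have := diam_lt_sq_of_burns hG hB
  rw [← hs]
  by_contra hc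
  simp [show s.length = 0 by omega] at this

/-- The form needed by `IsWalkSeq.burns`: a walk of length at most d has at most d - 1 ≤ t² interior
vertices. -/
theorem le_ceil_sqrt_mul_self (d : ℕ) :
    d ≤ ⌈Real.sqrt ((d : ℝ) - 1)⌉₊ * ⌈Real.sqrt ((d : ℝ) - 1)⌉₊ + 1 := by
  have h := Nat.le_ceil (Real.sqrt ((d : ℝ) - 1))
  have h₂ : (d : ℝ) - 1 ≤ (⌈Real.sqrt ((d : ℝ) - 1)⌉₊ : ℝ) ^ 2 := (Real.sqrt_le_iff.1 h).2
  have : (d : ℝ) ≤ (⌈Real.sqrt ((d : ℝ) - 1)⌉₊ * ⌈Real.sqrt ((d : ℝ) - 1)⌉₊ + 1 : ℕ) := by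
    push_cast
    nlinarith
  exact_mod_cast this

theorem algorithm_spec (c : ℕ) (hc : 1 ≤ c) (hG : G.Connected) (D : Option (PathDecomposition G)) :
    ∃ σ : List (Fin n), ((algorithm c).exec (inputStore G D)).Outputs σ ∧ Burns G σ ∧
      (G.diam ≤ c → σ.length ≤ burningNumber G) ∧
      (c < G.diam → σ.length ≤ ⌈Real.sqrt ((G.diam : ℝ) - 1)⌉₊ + pathLength G) := by
  have hne := hG.nonempty
  have : NeZero n := ⟨by rintro rfl; exact hne.elim fun v => v.elim0⟩
  have hn : 0 < n := Nat.pos_of_ne_zero (NeZero.ne n)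
  have hs₀ := inputStore_ok G D
  have hs₁ := (Cmd.fill_preserving (a := 3) (e := .reg 20) (by omega) _ hs₀).1
  have hcol := Cmd.fill_spec (a := 3) (e := .reg 20) hs₀.1.1 (f := enumeration n)
    (fun i hi s' h _ => by simp [Expr.eval, h, enumeration, Nat.mod_eq_of_lt hi])
  simp only [algorithm, Cmd.exec_seq]
  generalize (Cmd.fill 3 (.reg 20)).exec (inputStore G D) = s₁ at hs₁ hcol
  have hcheck := Cmd.check_spec hs₁
  have hs₂ := hcheck.1.1
  have hn₂ := hcheck.2 _ hcol n hn le_rfl (burns_enumeration hG)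
  have hcol₂ : Column 3 (Cmd.check.exec s₁) (enumeration n) := by
    unfold Column
    rw [(Cmd.exec_frame _ _).2 3 (by simp [Cmd.check_tabs])]
    exact hcol
  generalize Cmd.check.exec s₁ = s₂ at hs₂ hn₂ hcol₂
  have hbrute := Cmd.brute_preserving (c + 1) s₂ hs₂
  have hpaths := Cmd.paths_preserving _ hbrute.1
  have hn₄ := hpaths.2 _ (hbrute.2 _ hn₂)
  obtain ⟨σ, hσ, hout⟩ := hpaths.1.2 hn₄.1
  have hle : ∀ K, Found (Cmd.paths.exec ((Cmd.brute (c + 1)).exec s₂)) K → σ.length ≤ K :=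
    fun K hK => hout.1 ▸ hK.2
  have hσn := hle n hn₄
  refine ⟨σ, hout, hσ, fun hd => ?_, fun hd => ?_⟩
  · obtain ⟨τ, hτ, hB⟩ := exists_burns_length_eq hG
    have hbc := burningNumber_le_diam hG
    have hbn := burningNumber_le (burns_enumeration hG)
    rw [length_prefixList] at hbn
    obtain ⟨f, hf⟩ := exists_prefixList_eq τ
    rw [hτ] at hf
    -- The search changes only the first c + 1 entries of the enumeration, so the optimal schedule
    -- is continued by the enumeration; bn(G) ≤ diam + 1 ≤ c + 1 makes these entries enough.
    have hB' : Burns G (prefixList (fun i => if i < burningNumber G then f i else enumeration n i)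
        (burningNumber G)) := by
      rw [prefixList_congr (g := f) fun i hi => by simp [hi], ← hf]
      exact hB
    refine hle _ (hpaths.2 _ (Cmd.found_brute hs₂ (fun i hi hin => ?_) (burningNumber_pos hG)
      hbn hB'))
    simp [show ¬i < burningNumber G by omega, hcol₂ i hin]
  · have hsq := le_ceil_sqrt_mul_self G.diam
    -- Here 1 ≤ c < diam is used; t ≥ 1 also supplies the extra round in the first case below.
    have ht : 0 < ⌈Real.sqrt ((G.diam : ℝ) - 1)⌉₊ := by
      rw [Nat.ceil_pos, Real.sqrt_pos, sub_pos, Nat.one_lt_cast]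
      omega
    generalize ⌈Real.sqrt ((G.diam : ℝ) - 1)⌉₊ = t at hsq ht
    obtain ⟨D', hD'⟩ := exists_length_eq_pathLength G
    rw [← hD']
    rcases D'.exists_dominating_pair with hall | ⟨u, v, huv⟩
    -- Now diam ≤ l, and diam + 1 ≤ t + l rounds with x activated in each suffice. This candidate is
    -- the walk of length 0 from x to x; if diam + 1 > n, the enumeration is short enough.
    · obtain ⟨x, y, hxy⟩ := G.exists_dist_eq_diam
      have hdl := hall x y
      rcases Nat.lt_or_ge n (G.diam + 1) with h | h
      · omega
      refine (hle _ (Cmd.found_paths hG hbrute.1 one_pos hn (Nat.succ_pos G.diam) h x x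
        (by simpa using hn) fun p hp => ?_)).trans (by omega)
      rw [SimpleGraph.dist_self] at hp
      rw [prefixList_congr (g := fun _ => x) fun i _ => hp.eq_of_le _ (Nat.zero_le _)]
      exact burns_prefixList_const hG x (dist_le_diam hG x)
    · rcases Nat.lt_or_ge n (t + D'.length) with h | h
      · omega
      have hlt := dist_lt_card hG v u
      have hdd := dist_le_diam hG v u
      exact hle _ (Cmd.found_paths hG hbrute.1 ht (by omega) (by omega) h u v hlt fun p hp =>
        hp.burns hG (by omega) hlt.le (huv p _ hp))

theorem eval_mono (P : Polynomial ℕ) {a b : ℕ} (h : a ≤ b) : P.eval a ≤ P.eval b := by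
  simp only [Polynomial.eval_eq_sum, Polynomial.sum]
  exact Finset.sum_le_sum fun i _ => Nat.mul_le_mul_left _ (Nat.pow_le_pow_left h i)

/-! ### The approximation factor -/

theorem sqrt_diam_lt_burningNumber {V : Type*} [Finite V] {G : SimpleGraph V}
    (hG : G.Connected) : Real.sqrt G.diam < burningNumber G := by
  obtain ⟨s, hs, hB⟩ := exists_burns_length_eq hG
  have := diam_lt_sq_of_burns hG hB
  rw [hs] at this
  rw [Real.sqrt_lt' (by exact_mod_cast burningNumber_pos hG), sq]
  exact_mod_cast this

/-- The approximation factor of a schedule with at most `⌈√(d - 1)⌉ + l` rounds. -/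
theorem div_burningNumber_lt {V : Type*} [Finite V] {G : SimpleGraph V} (hG : G.Connected)
    (hd : 0 < G.diam) {k l : ℕ} (hl : 0 < l) (hk : k ≤ ⌈Real.sqrt ((G.diam : ℝ) - 1)⌉₊ + l) :
    (k : ℝ) / (burningNumber G : ℝ) < 1 + (l : ℝ) / Real.sqrt (G.diam : ℝ) := by
  have hb := sqrt_diam_lt_burningNumber hG
  have hsd : 0 < Real.sqrt (G.diam : ℝ) := Real.sqrt_pos.2 (by exact_mod_cast hd)
  -- bn(G) is an integer above √d ≥ √(d-1), so rounding up does not pass it.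
  have hceil : ⌈Real.sqrt ((G.diam : ℝ) - 1)⌉₊ ≤ burningNumber G :=
    Nat.ceil_le.2 ((Real.sqrt_le_sqrt (by linarith)).trans hb.le)
  have hk' : (k : ℝ) ≤ burningNumber G + l := by exact_mod_cast hk.trans (by omega)
  have hb0 := hsd.trans hb
  have hl' : (0 : ℝ) < l := by exact_mod_cast hl
  calc (k : ℝ) / burningNumber G ≤ (burningNumber G + l) / burningNumber G := by gcongr
    _ = 1 + l / burningNumber G := by field_simp
    _ < 1 + l / Real.sqrt G.diam := by gcongr

end Burning

theorem mainTheorem6 (c : ℕ) (hc : 1 ≤ c) :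
    ∃ (p : Burning.Program)
      (A : (n : ℕ) → (G : SimpleGraph (Fin n)) → Option (Burning.PathDecomposition G) →
        List (Fin n)),
      Burning.PolyTimeComputes p A ∧
      (∀ (n : ℕ) (G : SimpleGraph (Fin n)) (D : Option (Burning.PathDecomposition G)),
        G.Connected →
          Burning.Burns G (A n G D) ∧
          (G.diam ≤ c → (A n G D).length = Burning.burningNumber G) ∧
          (c < G.diam →
            (A n G D).length ≤ ⌈Real.sqrt ((G.diam : ℝ) - 1)⌉₊ + Burning.availableLength D ∧
            ((A n G D).length : ℝ) / (Burning.burningNumber G : ℝ) <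
              1 + (Burning.availableLength D : ℝ) / Real.sqrt (G.diam : ℝ))) ∧
      (∀ L : ℕ, ∃ ε : ℕ → ℝ, Filter.Tendsto ε Filter.atTop (nhds 0) ∧
        ∀ (n : ℕ) (G : SimpleGraph (Fin n)) (D : Option (Burning.PathDecomposition G)),
          G.Connected → Burning.pathLength G ≤ L → (∀ D' ∈ D, D'.length ≤ L) →
            ((A n G D).length : ℝ) ≤ (1 + ε G.diam) * (Burning.burningNumber G : ℝ)) := by
  classical
  obtain ⟨A, hA⟩ : ∃ A : (n : ℕ) → (G : SimpleGraph (Fin n)) →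
      Option (Burning.PathDecomposition G) → List (Fin n), ∀ n G D, G.Connected →
        ((Burning.algorithm c).exec (Burning.inputStore G D)).Outputs (A n G D) ∧
        Burning.Burns G (A n G D) ∧
        (G.diam ≤ c → (A n G D).length ≤ Burning.burningNumber G) ∧
        (c < G.diam →
          (A n G D).length ≤ ⌈Real.sqrt ((G.diam : ℝ) - 1)⌉₊ + Burning.pathLength G) := by
    refine ⟨fun n G D => if hG : G.Connected then (Burning.algorithm_spec c hc hG D).choose else [],
      fun n G D hG => ?_⟩
    simp only [dif_pos hG]
    exact (Burning.algorithm_spec c hc hG D).choose_spec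
  have hspec : ∀ (n : ℕ) (G : SimpleGraph (Fin n)) (D : Option (Burning.PathDecomposition G)),
      G.Connected →
        Burning.Burns G (A n G D) ∧
        (G.diam ≤ c → (A n G D).length = Burning.burningNumber G) ∧
        (c < G.diam →
          (A n G D).length ≤ ⌈Real.sqrt ((G.diam : ℝ) - 1)⌉₊ + Burning.availableLength D ∧
          ((A n G D).length : ℝ) / (Burning.burningNumber G : ℝ) <
            1 + (Burning.availableLength D : ℝ) / Real.sqrt (G.diam : ℝ)) := by
    intro n G D hG
    obtain ⟨-, hB, h₁, h₂⟩ := hA n G D hG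
    refine ⟨hB, fun hd => le_antisymm (h₁ hd) (Burning.burningNumber_le hB), fun hd => ?_⟩
    have hle := (h₂ hd).trans (Nat.add_le_add_left (Burning.pathLength_le_availableLength D) _)
    refine ⟨hle, Burning.div_burningNumber_lt hG (by omega) ?_ hle⟩
    have := SimpleGraph.nontrivial_of_diam_ne_zero (show G.diam ≠ 0 by omega)
    obtain ⟨v⟩ := hG.nonempty
    obtain ⟨w, hw⟩ := hG.preconnected.exists_adj_of_nontrivial v
    exact (Burning.pathLength_pos hw).trans_le (Burning.pathLength_le_availableLength D)
  refine ⟨(Burning.algorithm c).compile, A, ⟨(Burning.algorithm c).cost, ?_⟩, hspec, ?_⟩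
  · intro n G D hG
    obtain ⟨t, hrun, ht⟩ := Burning.Cmd.run_compile (Burning.algorithm_wf c)
      (Burning.inputStore G D)
    exact ⟨_, t, hrun, ht.trans (Burning.eval_mono _ (by simp [Burning.inputStore])),
      (hA n G D hG).1⟩
  · intro L
    -- The factor 2 covers the case without a decomposition, where ℓ = 2 pl(G). For d ≤ c, including
    -- the value 0 at d = 0, only ε ≥ 0 is needed, because there k = bn(G).
    refine ⟨fun d => (2 * L : ℝ) / Real.sqrt d, ?_, fun n G D hG hL hD => ?_⟩
    · exact (Real.tendsto_sqrt_atTop.comp tendsto_natCast_atTop_atTop).const_div_atTop _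
    have hb : (0 : ℝ) < Burning.burningNumber G := by exact_mod_cast Burning.burningNumber_pos hG
    obtain ⟨-, h₁, h₂⟩ := hspec n G D hG
    rcases Nat.lt_or_ge c G.diam with hd | hd
    · have hl : Burning.availableLength D ≤ 2 * L := by
        cases D with
        | none => simpa [Burning.availableLength] using hL
        | some D =>
          have : D.length ≤ L := hD D rfl
          simp only [Burning.availableLength]
          omega
      have hl' : (Burning.availableLength D : ℝ) ≤ 2 * L := by exact_mod_cast hl
      rw [← div_le_iff₀ hb]
      refine (h₂ hd).2.le.trans ?_
      beta_reduce
      gcongr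
    · rw [h₁ hd]
      exact le_mul_of_one_le_left hb.le (le_add_of_nonneg_right (by positivity))
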